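/- Fix $\lambda>0$, identify $S^1=\mathbb R/2\pi\mathbb Z$, and let $c:S^1\to\mathbb R^2$ be a rectifiable closed curve, i.e. a continuous map of finite length (bounded variation). Then there is a sequence $(c_n)$ of smooth ($C^\infty$) immersed closed curves $c_n:S^1\to\mathbb R^2$ such that $$\lim_{n\to\infty} d_{H^1}(c,c_n)=0 .$$ Here, for a curve $c$ of length $L$ and a field $h:S^1\to\mathbb R^2$ along $c$, $$\|h\|_{H^1}^2=\frac1L\int_{S^1}|h|^2\,ds+\lambda L^2\,\frac1L\int_{S^1}|D_sh|^2\,ds,\qquad ds=|\partial_u c|\,du,\quad D_s=\frac{1}{|\partial_u c|}\partial_u ,$$ and the distance induced by $H^1$ is the geometric distance $$d_{H^1}(c_0,c_1)=\inf_C \int_0^1\big\|\partial_t C(\cdot,t)\big\|_{H^1}\,dt ,$$ the norm being taken along the curve $C(\cdot,t)$. The infimum is over all homotopies $C:S^1\times[0,1]\to\mathbb R^2$ such that $t\mapsto C(\cdot,t)$ is a $C^1$ path in the Sobolev space $H^1(S^1,\mathbb R^2)$; each $C(\cdot,t)$ is immersed in the sense that $\partial_uC(u,t)\ne0$ for almost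 every $u$ (only $C(\cdot,0)$ and $C(\cdot,1)$ are also allowed to be constant curves); and $C(\cdot,0)$, $C(\cdot,1)$ coincide with $c_0$, $c_1$ respectively up to orientation-preserving reparametrization. Two closed curves coincide up to orientation-preserving reparametrization if they are of the form $\gamma\circ\varphi_0$ and $\gamma\circ\varphi_1$ for one continuous closed curve $\gamma$ and continuous, weakly monotone, orientation-preserving maps $\varphi_0,\varphi_1$ of $S^1$ onto itself of degree one. -/

import Mathlib

open MeasureTheory Set Filter Topology
open scoped ENNReal ContDiff

noncomputable section

namespace H1Curves

/-- The Euclidean plane. -/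
abbrev Plane : Type := EuclideanSpace ℝ (Fin 2)

/-- The parameter circle is `ℝ / 2πℤ`; a closed curve (or a vector field along one) is a
continuous `2π`-periodic function on `ℝ`. -/
def IsClosedCurve (c : ℝ → Plane) : Prop :=
  Continuous c ∧ Function.Periodic c (2 * Real.pi)

/-- Rectifiable closed curves: continuous closed curves of finite length, the length being the
total variation over one period. -/
def IsRectifiable (c : ℝ → Plane) : Prop :=
  IsClosedCurve c ∧ BoundedVariationOn c (Icc 0 (2 * Real.pi))

/-- Smooth (`C^∞`) immersed closed curves. -/
def IsSmoothImmersed (c : ℝ → Plane) : Prop :=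
  IsClosedCurve c ∧ ContDiff ℝ ∞ c ∧ ∀ u, deriv c u ≠ 0

/-- Lift to `ℝ` of a continuous, weakly monotone, orientation preserving map of degree one of the
circle onto itself. -/
def IsParamChange (φ : ℝ → ℝ) : Prop :=
  Continuous φ ∧ Monotone φ ∧ ∀ u, φ (u + 2 * Real.pi) = φ u + 2 * Real.pi

/-- `c₀` and `c₁` are the same oriented geometric curve: both are obtained from one closed curve
by changes of parameter. A rectifiable curve need not be parametrized by an immersion, so the
changes of parameter are allowed to be constant on intervals; between smooth immersed curves the
relation is that of being equal up to an orientation preserving diffeomorphism of the circle. -/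
def SameGeometricCurve (c₀ c₁ : ℝ → Plane) : Prop :=
  ∃ (γ : ℝ → Plane) (φ₀ φ₁ : ℝ → ℝ), IsClosedCurve γ ∧ IsParamChange φ₀ ∧ IsParamChange φ₁ ∧
    c₀ = γ ∘ φ₀ ∧ c₁ = γ ∘ φ₁

/-- The length `∫ |c'(u)| du` of an absolutely continuous closed curve. -/
def len (c : ℝ → Plane) : ℝ≥0∞ :=
  ∫⁻ u in Ioc 0 (2 * Real.pi), ‖deriv c u‖ₑ

/-- The average `(1 / L) ∫ f ds` along `c` of a nonnegative function `f` of the parameter, where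
`ds = |c'(u)| du` and `L` is the length of `c`. -/
def avg (c : ℝ → Plane) (f : ℝ → ℝ≥0∞) : ℝ≥0∞ :=
  (len c)⁻¹ * ∫⁻ u in Ioc 0 (2 * Real.pi), f u * ‖deriv c u‖ₑ

/-- The `H¹` norm `‖h‖² = (1/L) ∫ |h|² ds + lam L² (1/L) ∫ |D_s h|² ds` of a field `h` along `c`,
with `D_s h = h'(u) / |c'(u)|`. -/
def normH1 (lam : ℝ) (c h : ℝ → Plane) : ℝ≥0∞ :=
  (avg c (fun u => ‖h u‖ₑ ^ 2) +
    ENNReal.ofReal lam * len c ^ 2 * avg c (fun u => (‖deriv h u‖ₑ / ‖deriv c u‖ₑ) ^ 2))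
      ^ (1 / 2 : ℝ)

/-- `t ↦ C t` is a `C¹` path, `t ∈ [0,1]`, in the Sobolev space `H¹(S¹, ℝ²)` of closed curves:
identifying a curve with its value at `0` and its weak derivative in `L²`, both are `C¹` in `t`. -/
def IsC1PathInH1 (C : ℝ → ℝ → Plane) : Prop :=
  (∀ t ∈ Icc (0 : ℝ) 1, Function.Periodic (C t) (2 * Real.pi)) ∧
  ContDiffOn ℝ 1 (fun t => C t 0) (Icc 0 1) ∧
  ∃ p : ℝ → Lp Plane 2 (volume.restrict (Ioc 0 (2 * Real.pi))),
    ContDiffOn ℝ 1 p (Icc 0 1) ∧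
    ∀ t ∈ Icc (0 : ℝ) 1, ∀ u ∈ Icc 0 (2 * Real.pi), C t u = C t 0 + ∫ x in (0 : ℝ)..u, p t x

/-- Homotopies `C t u` of immersed curves, `t ∈ [0,1]`: a `C¹` path in `H¹(S¹, ℝ²)` all of whose
curves are immersed in the sense that the derivative in `u` is nonzero almost everywhere; only an
end curve is also allowed to be a constant curve (at which the metric is not defined). -/
def IsHomotopy (C : ℝ → ℝ → Plane) : Prop :=
  IsC1PathInH1 C ∧
  ∀ t ∈ Icc (0 : ℝ) 1,
    (∀ᵐ u : ℝ, deriv (C t) u ≠ 0) ∨ ((t = 0 ∨ t = 1) ∧ ∀ u, C t u = C t 0)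

/-- The length `∫₀¹ ‖∂_t C(·,t)‖ dt` of a homotopy, the norm being the `H¹` norm along `C(·,t)`. -/
def lenH1 (lam : ℝ) (C : ℝ → ℝ → Plane) : ℝ≥0∞ :=
  ∫⁻ t in Ioo (0 : ℝ) 1, normH1 lam (C t) (fun u => deriv (fun τ => C τ u) t)

/-- The geometric distance induced by the `H¹` metric: the infimum of the lengths of the homotopies
that connect a reparametrization of `c₀` to a reparametrization of `c₁`. -/
def distH1 (lam : ℝ) (c₀ c₁ : ℝ → Plane) : ℝ≥0∞ :=
  ⨅ (C : ℝ → ℝ → Plane) (_ : IsHomotopy C ∧ SameGeometricCurve c₀ (C 0) ∧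
    SameGeometricCurve (C 1) c₁), lenH1 lam C

end H1Curves

end

noncomputable section

namespace H1Curves

/-! Write the velocity of a plane curve as a complex square, `y ^ 2`. If `y` moves with `t`, the
velocity moves by `2 * y * y'` (prime for the `t`-derivative) while `ds = |y| ^ 2 du`, so `|D_s h| ^
2 ds = 4 |y'| ^ 2 du` wherever `y ≠ 0`. The derivative term of the norm is thus at most `4 λ L ∫
|y'| ^ 2 du`, however small the speed is, and the average of `|h| ^ 2` is at most the square of its
supremum. Curves whose square roots are joined by an `L²`-short path are therefore close
(`lenH1_squareHomotopy_le`). The root need only be measurable and bounded.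

With `y = e + i f`, the curve closes up exactly when `e` and `f` are orthogonal in `L²` and have
equal norms. A nonconstant rectifiable curve has a constant-speed parametrization
(`IsRectifiable.exists_constantSpeed`); the principal root of its velocity has `e ≥ 0`. Mollify `e`
and `f` and add a small positive constant to `e`: this gives a smooth nearby pair with positive
first component. Along the segment joining the pairs, closure is restored by Gram–Schmidt, which
replaces `(e, f)` by `(D e, E f - F e) / κ`, where `E`, `F`, `H` are the Gram entries, `D ^ 2 = E H
- F ^ 2`, and `κ` here is the initial common value of `E` and `H`. The correction is the identity at
the start and moves slowly when the segment is short. It multiplies `e` by a positive factor, so the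
root has positive real part for `t > 0` and the end curve is a smooth immersion (`exists_homotopy`,
`exists_approx_of_constantSpeed`). A constant curve is instead blown up to a small circle
(`exists_approx_of_const`). -/

/-! ### Homotopies through squares, and their `H¹` length -/

/-- The identification of the complex plane with the Euclidean plane. -/
def toPlane : ℂ ≃ₗᵢ[ℝ] Plane := Complex.orthonormalBasisOneI.repr

/-- The separated sum `∑ a j t * Y j u`, regarded as a path `t ↦ (u ↦ ·)` of functions. -/
def sepSum {m : ℕ} (a Y : Fin m → ℝ → ℂ) (t u : ℝ) : ℂ := ∑ j, a j t * Y j u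

/-- The path of curves that start at `P` and whose derivatives are the squares of `y t`. -/
def squareHomotopy (P : Plane) (y : ℝ → ℝ → ℂ) (t u : ℝ) : Plane :=
  P + toPlane (∫ x in (0 : ℝ)..u, y t x ^ 2)

theorem locallyIntegrable_of_bounded {E : Type*} [NormedAddCommGroup E] {f : ℝ → E} {B : ℝ}
    (hf : AEStronglyMeasurable f volume) (hB : ∀ u, ‖f u‖ ≤ B) : LocallyIntegrable f volume :=
  (locallyIntegrable_const B).mono hf (Eventually.of_forall fun u =>
    (hB u).trans (le_abs_self B))

theorem intervalIntegrable_of_locallyIntegrable {E : Type*} [NormedAddCommGroup E] {f : ℝ → E}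
    (hf : LocallyIntegrable f volume) (a b : ℝ) : IntervalIntegrable f volume a b :=
  intervalIntegrable_iff.2 ((hf.integrableOn_isCompact isCompact_uIcc).mono_set uIoc_subset_uIcc)

theorem sepSum_mul {m : ℕ} (a b Y : Fin m → ℝ → ℂ) (t u : ℝ) :
    sepSum a Y t u * sepSum b Y t u = ∑ j, ∑ k, (a j t * b k t) * (Y j u * Y k u) := by
  simp only [sepSum, Finset.sum_mul_sum]
  exact Finset.sum_congr rfl fun j _ => Finset.sum_congr rfl fun k _ => by ring

section

variable {m : ℕ} {a Y : Fin m → ℝ → ℂ} {B : ℝ}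

theorem measurable_sepSum (hY : ∀ j, Measurable (Y j)) (t : ℝ) : Measurable (sepSum a Y t) := by
  unfold sepSum
  exact Finset.measurable_sum _ fun j _ => (hY j).const_mul _

theorem norm_sepSum_le (hB : ∀ j u, ‖Y j u‖ ≤ B) (t u : ℝ) :
    ‖sepSum a Y t u‖ ≤ ∑ j, ‖a j t‖ * B := by
  refine (norm_sum_le _ _).trans (Finset.sum_le_sum fun j _ => ?_)
  rw [norm_mul]
  exact mul_le_mul_of_nonneg_left (hB j u) (norm_nonneg _)

theorem locallyIntegrable_sepSum_mul (hY : ∀ j, Measurable (Y j)) (hB : ∀ j u, ‖Y j u‖ ≤ B)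
    (b : Fin m → ℝ → ℂ) (t : ℝ) :
    LocallyIntegrable (fun u => sepSum a Y t u * sepSum b Y t u) volume := by
  refine locallyIntegrable_of_bounded (B := (∑ j, ‖a j t‖ * B) * ∑ j, ‖b j t‖ * B)
    ((measurable_sepSum hY t).mul (measurable_sepSum hY t)).aestronglyMeasurable fun u => ?_
  rw [norm_mul]
  exact mul_le_mul (norm_sepSum_le hB t u) (norm_sepSum_le hB t u) (norm_nonneg _)
    ((norm_nonneg _).trans (norm_sepSum_le hB t u))

theorem locallyIntegrable_mul (hY : ∀ j, Measurable (Y j)) (hB : ∀ j u, ‖Y j u‖ ≤ B)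
    (j k : Fin m) : LocallyIntegrable (fun u => Y j u * Y k u) volume := by
  refine locallyIntegrable_of_bounded (B := B * B) ((hY j).mul (hY k)).aestronglyMeasurable
    fun u => ?_
  rw [norm_mul]
  exact mul_le_mul (hB j u) (hB k u) (norm_nonneg _) ((norm_nonneg _).trans (hB j u))

/-- Separation of variables leaves the dependence on `t` in finitely many scalar coefficients, so
time derivatives need no differentiation under the integral sign. -/
theorem integral_sepSum_mul (hY : ∀ j, Measurable (Y j)) (hB : ∀ j u, ‖Y j u‖ ≤ B)
    (b : Fin m → ℝ → ℂ) (t u : ℝ) :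
    ∫ x in (0 : ℝ)..u, sepSum a Y t x * sepSum b Y t x =
      ∑ j, ∑ k, (a j t * b k t) * ∫ x in (0 : ℝ)..u, Y j x * Y k x := by
  simp only [sepSum_mul]
  have hi : ∀ j k, IntervalIntegrable (fun x => (a j t * b k t) * (Y j x * Y k x)) volume 0 u :=
    fun j k => (intervalIntegrable_of_locallyIntegrable (locallyIntegrable_mul hY hB j k) _ _).const_mul _
  have hi' : ∀ j, IntervalIntegrable (fun x => ∑ k, (a j t * b k t) * (Y j x * Y k x)) volume 0 u :=
    fun j => by
      rw [← Finset.sum_fn]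
      exact IntervalIntegrable.sum Finset.univ fun k _ => hi j k
  rw [intervalIntegral.integral_finsetSum fun j _ => hi' j]
  refine Finset.sum_congr rfl fun j _ => ?_
  rw [intervalIntegral.integral_finsetSum fun k _ => hi j k]
  exact Finset.sum_congr rfl fun k _ => intervalIntegral.integral_const_mul _ _

theorem ae_deriv_toPlane_integral {f : ℝ → ℂ} (hf : LocallyIntegrable f volume) (P : Plane) :
    ∀ᵐ u, deriv (fun u => P + toPlane (∫ x in (0 : ℝ)..u, f x)) u = toPlane (f u) := by
  filter_upwards [LocallyIntegrable.ae_hasDerivAt_integral hf] with u hu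
  exact ((toPlane.toContinuousLinearEquiv.hasFDerivAt.comp_hasDerivAt u (hu 0)).const_add P).deriv

theorem ae_deriv_squareHomotopy (hY : ∀ j, Measurable (Y j)) (hB : ∀ j u, ‖Y j u‖ ≤ B)
    (P : Plane) (t : ℝ) :
    ∀ᵐ u, deriv (squareHomotopy P (sepSum a Y) t) u = toPlane (sepSum a Y t u ^ 2) := by
  have := ae_deriv_toPlane_integral (locallyIntegrable_sepSum_mul (a := a) hY hB a t) P
  simp only [← sq] at this
  exact this

/-- The velocity is a finite combination of the fixed `L²` elements `Y j * Y k` with `C¹`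
coefficients `a j * a k`, hence a `C¹` path in `L²`. The hypothesis `hint` closes the curves. -/
theorem isC1PathInH1_squareHomotopy (hY : ∀ j, Measurable (Y j)) (hB : ∀ j u, ‖Y j u‖ ≤ B)
    (ha : ∀ j, ContDiffOn ℝ 1 (a j) (Icc 0 1)) (P : Plane)
    (hper : ∀ t ∈ Icc (0 : ℝ) 1, Function.Periodic (fun u => sepSum a Y t u ^ 2) (2 * Real.pi))
    (hint : ∀ t ∈ Icc (0 : ℝ) 1, ∫ u in (0 : ℝ)..2 * Real.pi, sepSum a Y t u ^ 2 = 0) :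
    IsC1PathInH1 (squareHomotopy P (sepSum a Y)) := by
  have hloc : ∀ t, LocallyIntegrable (fun u => sepSum a Y t u ^ 2) volume := fun t => by
    simpa only [← sq] using locallyIntegrable_sepSum_mul (a := a) hY hB a t
  refine ⟨fun t ht u => ?_, ?_, ?_⟩
  · simp only [squareHomotopy]
    congr 2
    rw [← intervalIntegral.integral_add_adjacent_intervals
      (intervalIntegrable_of_locallyIntegrable (hloc t) 0 u)
      (intervalIntegrable_of_locallyIntegrable (hloc t) u _),
      (hper t ht).intervalIntegral_add_eq u 0, zero_add, hint t ht, add_zero]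
  · simpa [squareHomotopy] using contDiffOn_const
  · set μ := volume.restrict (Ioc 0 (2 * Real.pi)) with hμ
    have hmem : ∀ j k, MemLp (fun u => Y j u * Y k u) 2 μ := fun j k =>
      MemLp.of_bound ((hY j).mul (hY k)).aestronglyMeasurable (B * B)
        (Eventually.of_forall fun u => by
          rw [norm_mul]
          exact mul_le_mul (hB j u) (hB k u) (norm_nonneg _) ((norm_nonneg _).trans (hB j u)))
    let q : ℝ → Lp ℂ 2 μ := fun t => ∑ j, ∑ k, (a j t * a k t) • (hmem j k).toLp
    let J : ℂ →L[ℝ] Plane := toPlane.toContinuousLinearEquiv.toContinuousLinearMap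
    refine ⟨fun t => J.compLpL 2 μ (q t), ?_, fun t _ u hu => ?_⟩
    · refine (J.compLpL 2 μ).contDiff.comp_contDiffOn ?_
      exact ContDiffOn.sum fun j _ => ContDiffOn.sum fun k _ =>
        ((ha j).mul (ha k)).smul contDiffOn_const
    · have h1 : ∀ᵐ x ∂μ, q t x = sepSum a Y t x ^ 2 := by
        have h2 : ∀ j k, ∀ᵐ x ∂μ, ((a j t * a k t) • (hmem j k).toLp : Lp ℂ 2 μ) x
            = (a j t * a k t) * (Y j x * Y k x) := fun j k => by
          filter_upwards [Lp.coeFn_smul (a j t * a k t) (hmem j k).toLp, (hmem j k).coeFn_toLp]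
            with x hx hx'
          rw [hx, Pi.smul_apply, hx', smul_eq_mul]
        have h3 := Lp.coeFn_finsetSum (p := 2) (μ := μ) Finset.univ
          (fun j => ∑ k, (a j t * a k t) • (hmem j k).toLp)
        have h4 : ∀ j, _ := fun j => Lp.coeFn_finsetSum (p := 2) (μ := μ) Finset.univ
          (fun k => (a j t * a k t) • (hmem j k).toLp)
        filter_upwards [ae_all_iff.2 fun j => ae_all_iff.2 (h2 j), h3, ae_all_iff.2 h4]
          with x hx hx3 hx4
        rw [sq, sepSum_mul]
        simp only [q]
        rw [hx3]
        simp only [Finset.sum_apply]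
        refine Finset.sum_congr rfl fun j _ => ?_
        rw [hx4 j]
        simp only [Finset.sum_apply]
        exact Finset.sum_congr rfl fun k _ => hx j k
      have h5 : ∀ᵐ x ∂μ, J.compLpL 2 μ (q t) x = J (sepSum a Y t x ^ 2) := by
        filter_upwards [J.coeFn_compLpL (q t), h1] with x hx hx'
        rw [hx, hx']
      have h6 : ∫ x in (0 : ℝ)..u, J.compLpL 2 μ (q t) x = J (∫ x in (0 : ℝ)..u, sepSum a Y t x ^ 2) := by
        rw [← J.intervalIntegral_comp_comm (intervalIntegrable_of_locallyIntegrable (hloc t) _ _)]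
        refine intervalIntegral.integral_congr_ae ?_
        rw [uIoc_of_le hu.1]
        filter_upwards [(ae_restrict_iff' measurableSet_Ioc).1 h5] with x hx hxu
        exact hx ⟨hxu.1, hxu.2.trans hu.2⟩
      rw [h6]
      simp [squareHomotopy, J]

theorem isHomotopy_squareHomotopy (hY : ∀ j, Measurable (Y j)) (hB : ∀ j u, ‖Y j u‖ ≤ B)
    (ha : ∀ j, ContDiffOn ℝ 1 (a j) (Icc 0 1)) (P : Plane)
    (hper : ∀ t ∈ Icc (0 : ℝ) 1, Function.Periodic (fun u => sepSum a Y t u ^ 2) (2 * Real.pi))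
    (hint : ∀ t ∈ Icc (0 : ℝ) 1, ∫ u in (0 : ℝ)..2 * Real.pi, sepSum a Y t u ^ 2 = 0)
    (hne : ∀ t ∈ Icc (0 : ℝ) 1, (∀ᵐ u, sepSum a Y t u ≠ 0) ∨
      ((t = 0 ∨ t = 1) ∧ ∀ u, sepSum a Y t u = 0)) :
    IsHomotopy (squareHomotopy P (sepSum a Y)) := by
  refine ⟨isC1PathInH1_squareHomotopy hY hB ha P hper hint, fun t ht => ?_⟩
  refine (hne t ht).imp (fun h => ?_) (fun h => ⟨h.1, fun u => ?_⟩)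
  · filter_upwards [h, ae_deriv_squareHomotopy (a := a) hY hB P t] with u hu hu'
    rw [hu']
    simpa using hu
  · simp [squareHomotopy, h.2]

theorem deriv_squareHomotopy (hY : ∀ j, Measurable (Y j)) (hB : ∀ j u, ‖Y j u‖ ≤ B)
    {t : ℝ} (ha : ∀ j, DifferentiableAt ℝ (a j) t) (P : Plane) (u : ℝ) :
    deriv (fun τ => squareHomotopy P (sepSum a Y) τ u) t =
      toPlane (∫ x in (0 : ℝ)..u,
        2 * (sepSum a Y t x * sepSum (fun j => deriv (a j)) Y t x)) := by
  have h1 : HasDerivAt (fun τ => ∑ j, ∑ k, (a j τ * a k τ) * ∫ x in (0 : ℝ)..u, Y j x * Y k x)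
      (∑ j, ∑ k, (deriv (a j) t * a k t + a j t * deriv (a k) t) *
        ∫ x in (0 : ℝ)..u, Y j x * Y k x) t :=
    HasDerivAt.fun_sum fun j _ => HasDerivAt.fun_sum fun k _ =>
      ((ha j).hasDerivAt.mul (ha k).hasDerivAt).mul_const _
  have h2 : (∑ j, ∑ k, (deriv (a j) t * a k t + a j t * deriv (a k) t) *
        ∫ x in (0 : ℝ)..u, Y j x * Y k x) = ∫ x in (0 : ℝ)..u,
        2 * (sepSum a Y t x * sepSum (fun j => deriv (a j)) Y t x) := by
    rw [intervalIntegral.integral_const_mul, two_mul]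
    -- Only one of the two copies is commuted, so that they match the two terms of the product rule.
    nth_rewrite 1 [show (fun x => sepSum a Y t x * sepSum (fun j => deriv (a j)) Y t x) =
      fun x => sepSum (fun j => deriv (a j)) Y t x * sepSum a Y t x from
        funext fun x => mul_comm _ _]
    rw [integral_sepSum_mul hY hB, integral_sepSum_mul hY hB]
    simp only [add_mul, Finset.sum_add_distrib]
  have h3 := (toPlane.toContinuousLinearEquiv.hasFDerivAt.comp_hasDerivAt t h1).const_add P
  rw [h2] at h3
  refine Eq.trans (congrArg (fun f => deriv f t) (funext fun τ => ?_)) h3.deriv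
  simp only [squareHomotopy, sq, integral_sepSum_mul hY hB]
  rfl

/-- This cancellation of `|z|` is the reason for square roots. For `z ≠ 0` it is an equality; at `z
= 0` the left side is `0` by the conventions for division. -/
theorem sq_div_mul_enorm_le (z w : ℂ) :
    (‖2 * (z * w)‖ₑ / ‖z ^ 2‖ₑ) ^ 2 * ‖z ^ 2‖ₑ ≤ 4 * ‖w‖ₑ ^ 2 := by
  rcases eq_or_ne z 0 with rfl | hz
  · simp
  have h : ‖z ^ 2‖₊ ≠ 0 := by simpa using hz
  simp only [enorm_eq_nnnorm]
  rw [← ENNReal.coe_div h]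
  norm_cast
  refine le_of_eq ?_
  have h' : ‖z‖₊ ≠ 0 := by simpa using hz
  simp only [nnnorm_mul, nnnorm_pow]
  have h2 : ‖(2 : ℂ)‖₊ = 2 := by ext; simp
  rw [h2]
  field_simp
  norm_num [mul_comm]

/-- The first summand bounds the field by its supremum, at most `∫ 2 |y| |y'|`; the second uses the
cancellation of `|y|`, with `K ^ 2 * 2π` bounding the length. No lower bound on the speed enters. -/
theorem normH1_squareHomotopy_le (hY : ∀ j, Measurable (Y j)) (hB : ∀ j u, ‖Y j u‖ ≤ B)
    {t : ℝ} (ha : ∀ j, DifferentiableAt ℝ (a j) t) (P : Plane) (lam : ℝ) {K : ℝ≥0∞} (hK : K ≠ ⊤)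
    {g : ℝ → ℝ≥0∞} (hyK : ∀ u, ‖sepSum a Y t u‖ₑ ≤ K)
    (hyg : ∀ u, ‖sepSum (fun j => deriv (a j)) Y t u‖ₑ ≤ g u) :
    normH1 lam (squareHomotopy P (sepSum a Y) t)
      (fun u => deriv (fun τ => squareHomotopy P (sepSum a Y) τ u) t) ≤
      ((2 * K * ∫⁻ u in Ioc 0 (2 * Real.pi), g u) ^ 2 + ENNReal.ofReal lam *
        ((K ^ 2 * ENNReal.ofReal (2 * Real.pi)) *
          (4 * ∫⁻ u in Ioc 0 (2 * Real.pi), g u ^ 2))) ^ (1 / 2 : ℝ) := by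
  set c := squareHomotopy P (sepSum a Y) t with hc
  set y := sepSum a Y t with hy
  set y' := sepSum (fun j => deriv (a j)) Y t with hy'
  have hh : (fun u => deriv (fun τ => squareHomotopy P (sepSum a Y) τ u) t) =
      fun u => toPlane (∫ x in (0 : ℝ)..u, 2 * (y x * y' x)) :=
    funext fun u => deriv_squareHomotopy hY hB ha P u
  rw [hh]
  have hdc : ∀ᵐ u, ‖deriv c u‖ₑ = ‖y u ^ 2‖ₑ := by
    filter_upwards [ae_deriv_squareHomotopy (a := a) hY hB P t] with u hu
    rw [hu, LinearIsometryEquiv.enorm_map]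
  have hloc : LocallyIntegrable (fun x => 2 * (y x * y' x)) volume :=
    (locallyIntegrable_sepSum_mul (a := a) hY hB (fun j => deriv (a j)) t).smul (2 : ℂ)
  have hdh : ∀ᵐ u, ‖deriv (fun u => toPlane (∫ x in (0 : ℝ)..u, 2 * (y x * y' x))) u‖ₑ =
      ‖2 * (y u * y' u)‖ₑ := by
    filter_upwards [ae_deriv_toPlane_integral hloc 0] with u hu
    simp only [zero_add] at hu
    rw [hu, LinearIsometryEquiv.enorm_map]
  have hlen : len c ≤ K ^ 2 * ENNReal.ofReal (2 * Real.pi) := by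
    calc len c = ∫⁻ u in Ioc 0 (2 * Real.pi), ‖y u ^ 2‖ₑ := lintegral_congr_ae (ae_restrict_of_ae hdc)
      _ ≤ ∫⁻ u in Ioc 0 (2 * Real.pi), K ^ 2 := lintegral_mono fun u => by
          rw [enorm_pow]; gcongr; exact hyK u
      _ = _ := by simp
  refine ENNReal.rpow_le_rpow (add_le_add ?_ ?_) (by norm_num)
  · have hsup : ∀ u ∈ Ioc 0 (2 * Real.pi), ‖toPlane (∫ x in (0 : ℝ)..u, 2 * (y x * y' x))‖ₑ ≤
        2 * K * ∫⁻ u in Ioc 0 (2 * Real.pi), g u := fun u hu => by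
      rw [LinearIsometryEquiv.enorm_map, intervalIntegral.integral_of_le hu.1.le]
      refine (enorm_integral_le_lintegral_enorm _).trans ?_
      rw [← lintegral_const_mul' _ _ (by finiteness)]
      refine (lintegral_mono_set (Ioc_subset_Ioc_right hu.2)).trans (lintegral_mono fun x => ?_)
      rw [enorm_mul, enorm_mul, mul_assoc]
      have h2 : ‖(2 : ℂ)‖ₑ = 2 := by
        simp [enorm_eq_nnnorm]
      rw [h2]
      gcongr
      exacts [hyK x, hyg x]
    calc avg c _ ≤ (len c)⁻¹ * ∫⁻ u in Ioc 0 (2 * Real.pi),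
          (2 * K * ∫⁻ u in Ioc 0 (2 * Real.pi), g u) ^ 2 * ‖deriv c u‖ₑ := by
          unfold avg
          gcongr 1
          refine setLIntegral_mono' measurableSet_Ioc fun u hu => ?_
          exact mul_le_mul' (pow_le_pow_left' (hsup u hu) 2) le_rfl
      _ = (2 * K * ∫⁻ u in Ioc 0 (2 * Real.pi), g u) ^ 2 * ((len c)⁻¹ * len c) := by
          rw [lintegral_const_mul _ (measurable_deriv c).enorm, len]
          ring
      -- An inequality suffices here, so a vanishing length needs no separate case.
      _ ≤ _ := mul_le_of_le_one_right' (ENNReal.inv_mul_le_one _)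
  · rw [mul_assoc]
    gcongr ENNReal.ofReal lam * ?_
    have hI : ∫⁻ u in Ioc 0 (2 * Real.pi), (‖deriv (fun u => toPlane (∫ x in (0 : ℝ)..u,
        2 * (y x * y' x))) u‖ₑ / ‖deriv c u‖ₑ) ^ 2 * ‖deriv c u‖ₑ ≤
        4 * ∫⁻ u in Ioc 0 (2 * Real.pi), g u ^ 2 := by
      rw [← lintegral_const_mul' _ _ (by finiteness)]
      refine lintegral_mono_ae (ae_restrict_of_ae ?_)
      filter_upwards [hdc, hdh] with u h1 h2
      rw [h1, h2]
      refine (sq_div_mul_enorm_le _ _).trans ?_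
      gcongr
      exact hyg u
    have hl : len c ^ 2 * (len c)⁻¹ ≤ len c := by
      rw [sq, mul_assoc]
      exact mul_le_of_le_one_right' (ENNReal.mul_inv_le_one _)
    unfold avg
    rw [← mul_assoc]
    exact mul_le_mul' (hl.trans hlen) hI

theorem lenH1_squareHomotopy_le (hY : ∀ j, Measurable (Y j)) (hB : ∀ j u, ‖Y j u‖ ≤ B)
    (ha : ∀ j, ContDiffOn ℝ 1 (a j) (Icc 0 1)) (P : Plane) (lam : ℝ) {K : ℝ≥0∞} (hK : K ≠ ⊤)
    {g : ℝ → ℝ≥0∞} (hyK : ∀ t ∈ Ioo (0 : ℝ) 1, ∀ u, ‖sepSum a Y t u‖ₑ ≤ K)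
    (hyg : ∀ t ∈ Ioo (0 : ℝ) 1, ∀ u, ‖sepSum (fun j => deriv (a j)) Y t u‖ₑ ≤ g u) :
    lenH1 lam (squareHomotopy P (sepSum a Y)) ≤
      ((2 * K * ∫⁻ u in Ioc 0 (2 * Real.pi), g u) ^ 2 + ENNReal.ofReal lam *
        ((K ^ 2 * ENNReal.ofReal (2 * Real.pi)) *
          (4 * ∫⁻ u in Ioc 0 (2 * Real.pi), g u ^ 2))) ^ (1 / 2 : ℝ) := by
  unfold lenH1
  refine (setLIntegral_mono' measurableSet_Ioo fun t ht => normH1_squareHomotopy_le hY hB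
    (fun j => ((ha j).differentiableOn one_ne_zero).differentiableAt (Icc_mem_nhds ht.1 ht.2))
    P lam hK (hyK t ht) (hyg t ht)).trans ?_
  simp

end

/-! ### Constant-speed parametrization of rectifiable curves -/

theorem integral_deriv_eq_sub_of_lipschitzWith {f : ℝ → Plane} {K : NNReal}
    (hf : LipschitzWith K f) (x y : ℝ) : ∫ u in x..y, deriv f u = f y - f x := by
  have hd := hf.ae_differentiableAt_real
  have hint : IntervalIntegrable (deriv f) volume x y := by
    refine (intervalIntegrable_const (c := (K : ℝ))).mono_fun
      (measurable_deriv f).aestronglyMeasurable (Eventually.of_forall fun u => ?_)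
    simpa using norm_deriv_le_of_lipschitz hf
  ext i
  let p : Plane →L[ℝ] ℝ := EuclideanSpace.proj i
  have hL : LipschitzWith _ (p ∘ f) := p.lipschitz.comp hf
  have h1 := (hL.lipschitzOnWith (s := uIcc x y)).absolutelyContinuousOnInterval.integral_deriv_eq_sub
  have h2 := p.intervalIntegral_comp_comm hint
  refine h2.symm.trans (Eq.trans ?_ h1)
  refine intervalIntegral.integral_congr_ae ?_
  filter_upwards [hd] with u hu _
  exact (p.hasFDerivAt.comp_hasDerivAt u hu.hasDerivAt).deriv.symm

theorem lipschitzWith_of_eVariationOn_eq {f : ℝ → Plane} {κ : NNReal}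
    (hf : ∀ x y, x ≤ y → eVariationOn f (Icc x y) = ENNReal.ofReal (κ * (y - x))) :
    LipschitzWith κ f := by
  have h : ∀ x y, x ≤ y → edist (f x) (f y) ≤ κ * edist x y := fun x y hxy => by
    refine (eVariationOn.edist_le f (left_mem_Icc.2 hxy) (right_mem_Icc.2 hxy)).trans_eq ?_
    rw [hf x y hxy, ENNReal.ofReal_mul κ.coe_nonneg, ENNReal.ofReal_coe_nnreal, edist_comm,
      edist_dist, Real.dist_eq, abs_of_nonneg (sub_nonneg.2 hxy)]
  intro x y
  rcases le_total x y with hxy | hxy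
  · exact h x y hxy
  · rw [edist_comm, edist_comm x]
    exact h y x hxy

/-- The variation of `f` is at most that of the primitive `G` of `‖deriv f‖`, while the Lipschitz
bound gives the opposite estimate. Hence `G` is linear with slope `κ`, and Lebesgue differentiation
identifies `‖deriv f‖` almost everywhere. -/
theorem ae_norm_deriv_eq_of_eVariationOn_eq {f : ℝ → Plane} {κ : NNReal}
    (hf : ∀ x y, x ≤ y → eVariationOn f (Icc x y) = ENNReal.ofReal (κ * (y - x))) :
    ∀ᵐ u, ‖deriv f u‖ = κ := by
  have hlip := lipschitzWith_of_eVariationOn_eq hf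
  have hle : ∀ u, ‖deriv f u‖ ≤ κ := fun u => norm_deriv_le_of_lipschitz hlip
  have hloc : LocallyIntegrable (fun u => ‖deriv f u‖) volume :=
    (locallyIntegrable_const (κ : ℝ)).mono (measurable_deriv f).norm.aestronglyMeasurable
      (Eventually.of_forall fun u => by simpa using hle u)
  have hint : ∀ x y, IntervalIntegrable (fun u => ‖deriv f u‖) volume x y := fun x y =>
    intervalIntegrable_iff.2 ((hloc.integrableOn_isCompact isCompact_uIcc).mono_set
      uIoc_subset_uIcc)
  set G : ℝ → ℝ := fun x => ∫ u in (0 : ℝ)..x, ‖deriv f u‖ with hG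
  have hGsub : ∀ x y, G y - G x = ∫ u in x..y, ‖deriv f u‖ := fun x y =>
    intervalIntegral.integral_interval_sub_left (hint _ _) (hint _ _)
  have hmono : Monotone G := fun x y hxy => by
    rw [← sub_nonneg, hGsub]
    exact intervalIntegral.integral_nonneg hxy fun u _ => norm_nonneg _
  have hfG : ∀ x y, x ≤ y → edist (f y) (f x) ≤ edist (G y) (G x) := fun x y hxy => by
    rw [edist_dist, edist_dist]
    refine ENNReal.ofReal_le_ofReal ?_
    rw [dist_eq_norm, ← integral_deriv_eq_sub_of_lipschitzWith hlip, Real.dist_eq, hGsub,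
      abs_of_nonneg (intervalIntegral.integral_nonneg hxy fun u _ => norm_nonneg _)]
    exact intervalIntegral.norm_integral_le_integral_norm hxy
  have hGle : ∀ x y, x ≤ y → κ * (y - x) ≤ G y - G x := fun x y hxy => by
    rw [← ENNReal.ofReal_le_ofReal_iff (sub_nonneg.2 (hmono hxy)), ← hf x y hxy]
    have h1 : eVariationOn f (Icc x y) ≤ eVariationOn G (Icc x y) :=
      iSup_mono fun p => Finset.sum_le_sum fun i _ => hfG _ _ (p.2.2.1 (Nat.le_succ i))
    refine h1.trans ?_
    have := (hmono.monotoneOn univ).eVariationOn_eq (mem_univ x) (mem_univ y)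
    simpa using this.le
  have hGge : ∀ x y, x ≤ y → G y - G x ≤ κ * (y - x) := fun x y hxy => by
    rw [hGsub]
    calc ∫ u in x..y, ‖deriv f u‖ ≤ ∫ u in x..y, (κ : ℝ) :=
          intervalIntegral.integral_mono_on hxy (hint _ _) intervalIntegrable_const
            fun u _ => hle u
      _ = κ * (y - x) := by simp [mul_comm]
  have hGeq : G = fun x => (κ : ℝ) * x := funext fun (x : ℝ) => by
    have h0 : G 0 = 0 := by simp [hG]
    rcases le_total 0 x with hx | hx
    · linarith [hGle 0 x hx, hGge 0 x hx]
    · linarith [hGle x 0 hx, hGge x 0 hx]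
  filter_upwards [LocallyIntegrable.ae_hasDerivAt_integral hloc] with u hu
  have h1 : HasDerivAt G ‖deriv f u‖ u := hu 0
  rw [hGeq] at h1
  exact h1.unique (by simpa using (hasDerivAt_id u).const_mul (κ : ℝ))

section

variable {c : ℝ → Plane} {T : ℝ}

theorem eVariationOn_Icc_add_period (hc : Function.Periodic c T) (x y : ℝ) :
    eVariationOn c (Icc (x + T) (y + T)) = eVariationOn c (Icc x y) := by
  have h := eVariationOn.comp_eq_of_monotoneOn c (t := Icc x y) (fun u => u + T)
    (fun _ _ _ _ h => by simpa using h)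
  rw [image_add_const_Icc, show c ∘ (fun u => u + T) = c from funext hc] at h
  exact h.symm

/-- Variation is additive over adjacent intervals and invariant under translation by periods, so
finiteness on one period spreads to every `[-nT, nT]`. -/
theorem locallyBoundedVariationOn_of_periodic (hT : 0 < T) (hc : Function.Periodic c T)
    (hbv : BoundedVariationOn c (Icc 0 T)) : LocallyBoundedVariationOn c univ := by
  have h1 : ∀ n : ℕ, eVariationOn c (Icc 0 (n * T)) ≠ ⊤ := by
    intro n
    induction n with
    | zero => simp [eVariationOn.subsingleton]
    | succ n ih =>
      have h := eVariationOn.Icc_add_Icc c (s := univ) (a := 0) (b := n * T)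
        (c := (n + 1 : ℕ) * T) (by positivity) (by push_cast; nlinarith) (mem_univ _)
      simp only [univ_inter] at h
      rw [← h]
      refine ENNReal.add_ne_top.2 ⟨ih, ?_⟩
      have h2 := eVariationOn_Icc_add_period (hc.nat_mul n) 0 T
      rw [zero_add, show T + n * T = (n + 1 : ℕ) * T by push_cast; ring] at h2
      rw [h2]
      exact hbv
  intro a b _ _
  obtain ⟨n, hn⟩ := exists_nat_ge ((|a| + |b|) / T)
  rw [div_le_iff₀ hT] at hn
  rw [univ_inter]
  have h2 : eVariationOn c (Icc (-(n * T)) (n * T)) ≠ ⊤ := by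
    have h := eVariationOn.Icc_add_Icc c (s := univ) (a := -(n * T)) (b := 0)
        (c := n * T) (by simpa using by positivity) (by positivity) (mem_univ _)
    simp only [univ_inter] at h
    rw [← h]
    refine ENNReal.add_ne_top.2 ⟨?_, h1 n⟩
    have h2 := eVariationOn_Icc_add_period (hc.nat_mul n) (-(n * T)) 0
    rw [neg_add_cancel, zero_add] at h2
    rw [← h2]
    exact h1 n
  refine BoundedVariationOn.mono h2 (Icc_subset_Icc ?_ ?_)
  · linarith [neg_abs_le a, abs_nonneg b]
  · linarith [le_abs_self b, abs_nonneg a]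

theorem continuous_variationOnFromTo (hc : Continuous c)
    (hbv : LocallyBoundedVariationOn c univ) (a : ℝ) :
    Continuous (variationOnFromTo c univ a) := by
  refine continuous_iff_continuousAt.2 fun b => continuousAt_iff_continuous_left'_right'.2 ⟨?_, ?_⟩
  · have := variationOnFromTo.tendsto_left (mem_univ a) (mem_univ b) hbv
      (hc.continuousAt.tendsto.mono_left nhdsWithin_le_nhds)
    simpa [ContinuousWithinAt] using this
  · have := variationOnFromTo.tendsto_right (mem_univ a) (mem_univ b) hbv
      (hc.continuousAt.tendsto.mono_left nhdsWithin_le_nhds)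
    simpa [ContinuousWithinAt] using this

theorem variationOnFromTo_add_period (hc : Function.Periodic c T)
    (hbv : LocallyBoundedVariationOn c univ) (u : ℝ) :
    variationOnFromTo c univ 0 (u + T) =
      variationOnFromTo c univ 0 u + variationOnFromTo c univ 0 T := by
  have h := variationOnFromTo.comp_eq_of_monotoneOn c (t := univ) (fun u => u + T)
    (fun _ _ _ _ h => by simpa using h) (mem_univ 0) (mem_univ u)
  rw [show c ∘ (fun u => u + T) = c from funext hc, image_univ,
    (add_right_surjective T).range_eq, zero_add] at h
  linarith [variationOnFromTo.add hbv (mem_univ 0) (mem_univ T) (mem_univ (u + T))]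

end

/-- A rectifiable closed curve is constant or has a parametrization of constant positive speed. -/
theorem IsRectifiable.exists_constantSpeed {c : ℝ → Plane} (hc : IsRectifiable c) :
    (∀ u, c u = c 0) ∨ ∃ (γ : ℝ → Plane) (φ : ℝ → ℝ) (κ : ℝ), 0 < κ ∧ IsClosedCurve γ ∧
      IsParamChange φ ∧ c = γ ∘ φ ∧ (∀ u, γ u = γ 0 + ∫ x in (0 : ℝ)..u, deriv γ x) ∧
      (∀ u, ‖deriv γ u‖ ≤ κ) ∧ ∀ᵐ u, ‖deriv γ u‖ = κ := by
  obtain ⟨⟨hcont, hper⟩, hbv0⟩ := hc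
  have hT : 0 < 2 * Real.pi := Real.two_pi_pos
  set T := 2 * Real.pi with hTdef
  have hbv := locallyBoundedVariationOn_of_periodic hT hper hbv0
  set V := variationOnFromTo c univ 0 with hV
  have hVc : Continuous V := continuous_variationOnFromTo hcont hbv 0
  have hVm : Monotone V := monotoneOn_univ.1 (variationOnFromTo.monotoneOn hbv (mem_univ 0))
  have hVT : ∀ u, V (u + T) = V u + V T := variationOnFromTo_add_period hper hbv
  have hV0 : V 0 = 0 := variationOnFromTo.self _ _ _
  have hVT0 : 0 ≤ V T := hV0 ▸ hVm hT.le
  rcases hVT0.eq_or_lt with hΛ | hΛ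
  · left
    intro u
    obtain ⟨v, hv, huv⟩ := hper.exists_mem_Ico₀ hT u
    rw [huv]
    have : V v = 0 := le_antisymm (hΛ ▸ hVm hv.2.le) (hV0 ▸ hVm hv.1)
    exact (edist_eq_zero.1
      (variationOnFromTo.edist_zero_of_eq_zero hbv (mem_univ 0) (mem_univ v) this)).symm
  · right
    have hVn : ∀ n : ℕ, V (n * T) = n * V T := fun n => by
      induction n with
      | zero => simp [hV0]
      | succ n ih => rw [Nat.cast_succ, add_mul, one_mul, hVT, ih]; ring
    have hVn' : ∀ n : ℕ, V (-(n * T)) = -(n * V T) := fun n => by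
      induction n with
      | zero => simp [hV0]
      | succ n ih =>
        have := hVT (-((n + 1 : ℕ) * T))
        rw [show -((n + 1 : ℕ) * T) + T = -(n * T) by push_cast; ring, ih] at this
        push_cast at this ⊢
        linarith
    -- Arclength grows by the positive amount `V T` in each period; surjectivity makes the natural
    -- parametrization have unit speed on all of `ℝ`.
    have hsurj : Function.Surjective V := by
      refine hVc.surjective (tendsto_atTop_atTop_of_monotone hVm fun b => ?_)
        (tendsto_atBot_atBot_of_monotone hVm fun b => ?_)
      · obtain ⟨n, hn⟩ := exists_nat_ge (b / V T)
        exact ⟨n * T, by rw [hVn]; exact (div_le_iff₀ hΛ).1 hn⟩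
      · obtain ⟨n, hn⟩ := exists_nat_ge (-b / V T)
        exact ⟨-(n * T), by rw [hVn']; linarith [(div_le_iff₀ hΛ).1 hn]⟩
    set γ₀ := naturalParameterization c univ 0 with hγ₀
    have hγV : ∀ u, γ₀ (V u) = c u := fun u =>
      edist_eq_zero.1 (edist_naturalParameterization_eq_zero hbv (mem_univ 0) (mem_univ u))
    have hunit := has_unit_speed_naturalParameterization c hbv (mem_univ 0)
    rw [image_univ, hsurj.range_eq] at hunit
    -- Speed length over `2π` makes the rescaled curve have period `2π` again.
    set κ := V T / T with hκ
    have hκ0 : 0 < κ := div_pos hΛ hT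
    set γ : ℝ → Plane := fun x => γ₀ (κ * x) with hγ
    have hvar : ∀ x y, x ≤ y → eVariationOn γ (Icc x y) =
        ENNReal.ofReal ((⟨κ, hκ0.le⟩ : NNReal) * (y - x)) := fun x y hxy => by
      have h := eVariationOn.comp_eq_of_monotoneOn γ₀ (t := Icc x y) (fun u => κ * u)
        (fun _ _ _ _ h => mul_le_mul_of_nonneg_left h hκ0.le)
      rw [image_mul_left_Icc hκ0.le hxy] at h
      have h' := hunit (mem_univ (κ * x)) (mem_univ (κ * y))
      rw [univ_inter] at h'
      refine (h.trans h').trans ?_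
      rw [NNReal.coe_one, one_mul, ← mul_sub]
    have hlip := lipschitzWith_of_eVariationOn_eq hvar
    refine ⟨γ, fun u => V u / κ, κ, hκ0, ⟨hlip.continuous, fun x => ?_⟩,
      ⟨hVc.div_const _, hVm.div_const hκ0.le, fun u => ?_⟩, funext fun u => ?_, fun u => ?_,
      fun u => norm_deriv_le_of_lipschitz hlip, ae_norm_deriv_eq_of_eVariationOn_eq hvar⟩
    · obtain ⟨u, hu⟩ := hsurj (κ * x)
      simp only [hγ]
      rw [mul_add, hκ, div_mul_cancel₀ _ hT.ne', ← hκ, ← hu, ← hVT, hγV, hγV, hper]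
    · simp only [← hTdef]
      rw [hVT, add_div, hκ, div_div_cancel₀ hΛ.ne']
    · simp only [hγ, Function.comp_apply]
      rw [mul_div_cancel₀ _ hκ0.ne', hγV]
    · rw [integral_deriv_eq_sub_of_lipschitzWith hlip]
      simp

/-! ### The Gram determinant along a segment -/

theorem abs_quadratic_le {b c η t : ℝ} (hb : |b| ≤ η) (hc : |c| ≤ η) (ht : t ∈ Icc (0 : ℝ) 1) :
    |b * t + c * t ^ 2| ≤ 2 * η := by
  have hη : 0 ≤ η := (abs_nonneg b).trans hb
  have h1 : |b * t| ≤ η := by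
    rw [abs_mul, abs_of_nonneg ht.1]
    exact (mul_le_of_le_one_right (abs_nonneg b) ht.2).trans hb
  have h2 : |c * t ^ 2| ≤ η := by
    rw [abs_mul, abs_of_nonneg (sq_nonneg t)]
    exact (mul_le_of_le_one_right (abs_nonneg c) (pow_le_one₀ ht.1 ht.2)).trans hc
  linarith [abs_add_le (b * t) (c * t ^ 2)]

theorem abs_deriv_quadratic_le {b c η t : ℝ} (hb : |b| ≤ η) (hc : |c| ≤ η)
    (ht : t ∈ Icc (0 : ℝ) 1) : |b + 2 * c * t| ≤ 3 * η := by
  have h2 : |2 * c * t| ≤ 2 * η := by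
    rw [abs_mul, abs_of_nonneg ht.1]
    refine (mul_le_of_le_one_right (abs_nonneg _) ht.2).trans ?_
    rw [abs_mul, abs_two]
    linarith
  linarith [abs_add_le b (2 * c * t)]

theorem hasDerivAt_quadratic (a b c t : ℝ) :
    HasDerivAt (fun t => a + (b * t + c * t ^ 2)) (b + 2 * c * t) t := by
  have h := ((((hasDerivAt_id t).const_mul b).add ((hasDerivAt_pow 2 t).const_mul c)).const_add a)
  convert! h using 1
  simp; ring

/-- The square root of the Gram determinant of a quadratic perturbation of `κ` times the
identity. -/
theorem exists_sqrt_gram {κ η e₁ e₂ f₁ f₂ h₁ h₂ : ℝ} (hκ : 0 < κ) (hη : η ≤ κ / 100)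
    (he₁ : |e₁| ≤ η) (he₂ : |e₂| ≤ η) (hf₁ : |f₁| ≤ η) (hf₂ : |f₂| ≤ η) (hh₁ : |h₁| ≤ η)
    (hh₂ : |h₂| ≤ η) :
    ∃ D : ℝ → ℝ, ContDiffOn ℝ 1 D (Icc 0 1) ∧ D 0 = κ ∧
      (∀ t ∈ Icc (0 : ℝ) 1, 0 < D t ∧ D t ≤ 2 * κ ∧
        D t ^ 2 = (κ + (e₁ * t + e₂ * t ^ 2)) * (κ + (h₁ * t + h₂ * t ^ 2)) -
          (0 + (f₁ * t + f₂ * t ^ 2)) ^ 2) ∧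
      ∀ t ∈ Ioo (0 : ℝ) 1, |deriv D t| ≤ 24 * η := by
  have hη0 : 0 ≤ η := (abs_nonneg e₁).trans he₁
  set E : ℝ → ℝ := fun t => κ + (e₁ * t + e₂ * t ^ 2) with hE
  set H : ℝ → ℝ := fun t => κ + (h₁ * t + h₂ * t ^ 2) with hH
  set F : ℝ → ℝ := fun t => 0 + (f₁ * t + f₂ * t ^ 2) with hF
  have key : ∀ t ∈ Icc (0 : ℝ) 1, 49 / 50 * κ ≤ E t ∧ E t ≤ 51 / 50 * κ ∧
      49 / 50 * κ ≤ H t ∧ H t ≤ 51 / 50 * κ ∧ |F t| ≤ 1 / 50 * κ := fun t ht => by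
    have h1 := abs_le.1 (abs_quadratic_le he₁ he₂ ht)
    have h2 := abs_le.1 (abs_quadratic_le hh₁ hh₂ ht)
    have h3 := abs_quadratic_le hf₁ hf₂ ht
    refine ⟨?_, ?_, ?_, ?_, ?_⟩ <;> simp only [hE, hH, hF, zero_add] <;> linarith [h1.1, h1.2, h2.1, h2.2]
  have hG : ∀ t ∈ Icc (0 : ℝ) 1, κ ^ 2 / 4 ≤ E t * H t - F t ^ 2 ∧
      E t * H t - F t ^ 2 ≤ (2 * κ) ^ 2 := fun t ht => by
    obtain ⟨h1, h2, h3, h4, h5⟩ := key t ht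
    have h6 : F t ^ 2 ≤ (1 / 50 * κ) ^ 2 := sq_le_sq' (abs_le.1 h5).1 (abs_le.1 h5).2
    have h7 : (49 / 50 * κ) * (49 / 50 * κ) ≤ E t * H t :=
      mul_le_mul h1 h3 (by positivity) (by linarith)
    have h8 : E t * H t ≤ (51 / 50 * κ) * (51 / 50 * κ) :=
      mul_le_mul h2 h4 (by linarith) (by positivity)
    constructor <;> nlinarith [sq_nonneg (F t), sq_nonneg κ]
  -- A lower bound for the root keeps it differentiable and controls the denominator `2 D` of its
  -- derivative.
  have hD2 : ∀ t ∈ Icc (0 : ℝ) 1, κ / 2 ≤ √(E t * H t - F t ^ 2) := fun t ht =>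
    Real.le_sqrt_of_sq_le (by linarith [(hG t ht).1])
  refine ⟨fun t => √(E t * H t - F t ^ 2), ?_, ?_, fun t ht => ⟨?_, ?_, ?_⟩, fun t ht => ?_⟩
  · refine ContDiffOn.sqrt (ContDiff.contDiffOn (by fun_prop)) fun t ht => ?_
    exact ((by positivity : 0 < κ ^ 2 / 4).trans_le (hG t ht).1).ne'
  · simp [hE, hH, hF, hκ.le]
  · linarith [hD2 t ht]
  · exact Real.sqrt_le_iff.2 ⟨by positivity, (hG t ht).2⟩
  · exact Real.sq_sqrt (by linarith [(hG t ht).1, sq_nonneg κ])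
  · have ht' := Ioo_subset_Icc_self ht
    have hpos : 0 < E t * H t - F t ^ 2 :=
      (by positivity : 0 < κ ^ 2 / 4).trans_le (hG t ht').1
    have hd := ((((hasDerivAt_quadratic κ e₁ e₂ t).mul (hasDerivAt_quadratic κ h₁ h₂ t)).sub
      ((hasDerivAt_quadratic 0 f₁ f₂ t).pow 2)).sqrt hpos.ne').deriv
    have hd' : deriv (fun t => √(E t * H t - F t ^ 2)) t =
        ((e₁ + 2 * e₂ * t) * H t + E t * (h₁ + 2 * h₂ * t) - 2 * (F t * (f₁ + 2 * f₂ * t))) /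
          (2 * √(E t * H t - F t ^ 2)) := by
      refine Eq.trans hd ?_
      simp only [hE, hF, hH, Pi.mul_apply, Pi.sub_apply, Pi.pow_apply]
      congr 1
      push_cast
      ring
    obtain ⟨k1, k2, k3, k4, k5⟩ := key t ht'
    have b1 := abs_deriv_quadratic_le he₁ he₂ ht'
    have b2 := abs_deriv_quadratic_le hf₁ hf₂ ht'
    have b3 := abs_deriv_quadratic_le hh₁ hh₂ ht'
    have c1 : |(e₁ + 2 * e₂ * t) * H t| ≤ 3 * η * (2 * κ) := by
      rw [abs_mul]
      exact mul_le_mul b1 (abs_le.2 ⟨by linarith, by linarith⟩) (abs_nonneg _) (by positivity)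
    have c2 : |E t * (h₁ + 2 * h₂ * t)| ≤ 2 * κ * (3 * η) := by
      rw [abs_mul]
      exact mul_le_mul (abs_le.2 ⟨by linarith, by linarith⟩) b3 (abs_nonneg _) (by positivity)
    have c3 : |F t * (f₁ + 2 * f₂ * t)| ≤ κ * (3 * η) := by
      rw [abs_mul]
      exact mul_le_mul (by linarith) b2 (abs_nonneg _) (by positivity)
    have hs := hD2 t ht'
    rw [hd', abs_div, abs_of_pos (a := 2 * _) (by linarith), div_le_iff₀ (by linarith)]
    -- The three products contribute `6 + 6 + 2 * 3`; since `2 D ≥ κ`, this leaves slack below `24 *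
    -- η`.
    have c4 : |(e₁ + 2 * e₂ * t) * H t + E t * (h₁ + 2 * h₂ * t) - 2 * (F t * (f₁ + 2 * f₂ * t))|
        ≤ 18 * (η * κ) := by
      rw [abs_le] at c1 c2 c3 ⊢
      constructor <;> linarith [c1.1, c1.2, c2.1, c2.2, c3.1, c3.2]
    nlinarith [mul_le_mul_of_nonneg_left hs hη0]

/-! ### Joining two square roots through closed curves -/

/-- The integral of the product of two functions over one period. -/
def ip (f g : ℝ → ℝ) : ℝ := ∫ u in (0 : ℝ)..2 * Real.pi, f u * g u

theorem intervalIntegrable_mul_of_bounded {f g : ℝ → ℝ} {K L : ℝ} (hf : Measurable f)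
    (hg : Measurable g) (hfK : ∀ u, |f u| ≤ K) (hgL : ∀ u, |g u| ≤ L) (a b : ℝ) :
    IntervalIntegrable (fun u => f u * g u) volume a b := by
  refine intervalIntegrable_of_locallyIntegrable (locallyIntegrable_of_bounded (B := K * L)
    (hf.mul hg).aestronglyMeasurable fun u => ?_) a b
  rw [Pi.mul_apply, norm_mul]
  exact mul_le_mul (hfK u) (hgL u) (norm_nonneg _) ((abs_nonneg _).trans (hfK u))

theorem abs_ip_le {f g d : ℝ → ℝ} {K : ℝ} (hd : IntervalIntegrable d volume 0 (2 * Real.pi))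
    (h : ∀ u, |f u * g u| ≤ K * d u) :
    |ip f g| ≤ K * ∫ u in (0 : ℝ)..2 * Real.pi, d u := by
  rw [← intervalIntegral.integral_const_mul]
  exact intervalIntegral.norm_integral_le_of_norm_le (f := fun u => f u * g u) Real.two_pi_pos.le
    (Eventually.of_forall fun u _ => h u) (hd.const_mul K)

theorem ip_line {f₀ g₀ d e : ℝ → ℝ} {K L : ℝ} (hf : Measurable f₀) (hg : Measurable g₀)
    (hd : Measurable d) (he : Measurable e) (hfK : ∀ u, |f₀ u| ≤ K) (hgK : ∀ u, |g₀ u| ≤ K)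
    (hdL : ∀ u, |d u| ≤ L) (heL : ∀ u, |e u| ≤ L) (t : ℝ) :
    ip (fun u => f₀ u + t * d u) (fun u => g₀ u + t * e u) =
      ip f₀ g₀ + ((ip f₀ e + ip d g₀) * t + ip d e * t ^ 2) := by
  have i1 := intervalIntegrable_mul_of_bounded hf hg hfK hgK 0 (2 * Real.pi)
  have i2 := intervalIntegrable_mul_of_bounded hf he hfK heL 0 (2 * Real.pi)
  have i3 := intervalIntegrable_mul_of_bounded hd hg hdL hgK 0 (2 * Real.pi)
  have i4 := intervalIntegrable_mul_of_bounded hd he hdL heL 0 (2 * Real.pi)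
  simp only [ip]
  rw [← intervalIntegral.integral_add i2 i3, ← intervalIntegral.integral_mul_const,
    ← intervalIntegral.integral_mul_const, ← intervalIntegral.integral_add
      ((i2.add i3).mul_const t) (i4.mul_const _), ← intervalIntegral.integral_add i1
      (((i2.add i3).mul_const t).add (i4.mul_const _))]
  exact intervalIntegral.integral_congr fun u _ => by ring

/-- This turns closure of the curve with velocity `(p e + q f) ^ 2` into an algebraic equation in
the Gram entries. -/
theorem integral_sq_add {e f : ℝ → ℝ} {K : ℝ} (he : Measurable e) (hf : Measurable f)
    (heK : ∀ u, |e u| ≤ K) (hfK : ∀ u, |f u| ≤ K) (p q : ℂ) :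
    ∫ u in (0 : ℝ)..2 * Real.pi, (p * e u + q * f u) ^ 2 =
      p ^ 2 * ip e e + 2 * p * q * ip e f + q ^ 2 * ip f f := by
  have cast : ∀ {h : ℝ → ℝ}, IntervalIntegrable h volume 0 (2 * Real.pi) →
      IntervalIntegrable (fun u => (h u : ℂ)) volume 0 (2 * Real.pi) :=
    fun h => ⟨h.1.ofReal, h.2.ofReal⟩
  have i1 := cast (intervalIntegrable_mul_of_bounded he he heK heK 0 (2 * Real.pi))
  have i2 := cast (intervalIntegrable_mul_of_bounded he hf heK hfK 0 (2 * Real.pi))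
  have i3 := cast (intervalIntegrable_mul_of_bounded hf hf hfK hfK 0 (2 * Real.pi))
  simp only [ip, ← intervalIntegral.integral_ofReal]
  rw [← intervalIntegral.integral_const_mul, ← intervalIntegral.integral_const_mul,
    ← intervalIntegral.integral_const_mul, ← intervalIntegral.integral_add
      (i1.const_mul _) (i2.const_mul _), ← intervalIntegral.integral_add
      ((i1.const_mul _).add (i2.const_mul _)) (i3.const_mul _)]
  exact intervalIntegral.integral_congr fun u _ => by push_cast; ring

/-- Two square roots `e₀ + i f₀` and `e₁ + i f₁` of velocities are joined by the squares of the
Gram–Schmidt orthonormalizations of the segment between them. -/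
theorem exists_homotopy {e₀ f₀ e₁ f₁ : ℝ → ℝ} {K κ η : ℝ}
    (he₀ : Measurable e₀) (hf₀ : Measurable f₀) (he₁ : Measurable e₁) (hf₁ : Measurable f₁)
    (he₀K : ∀ u, |e₀ u| ≤ K) (hf₀K : ∀ u, |f₀ u| ≤ K) (he₁K : ∀ u, |e₁ u| ≤ K)
    (hf₁K : ∀ u, |f₁ u| ≤ K) (he₀p : Function.Periodic e₀ (2 * Real.pi))
    (hf₀p : Function.Periodic f₀ (2 * Real.pi)) (he₁p : Function.Periodic e₁ (2 * Real.pi))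
    (hf₁p : Function.Periodic f₁ (2 * Real.pi)) (hκ : 0 < κ) (hE : ip e₀ e₀ = κ)
    (hH : ip f₀ f₀ = κ) (hF : ip e₀ f₀ = 0)
    (hη : 2 * K * ∫ u in (0 : ℝ)..2 * Real.pi, (|e₁ u - e₀ u| + |f₁ u - f₀ u|) = η)
    (hηκ : η ≤ κ / 100) (he₀0 : ∀ u, 0 ≤ e₀ u) (he₁0 : ∀ u, 0 < e₁ u)
    (hne : ∀ᵐ u, e₀ u ≠ 0 ∨ f₀ u ≠ 0) (P : Plane) (lam : ℝ) :
    ∃ (C : ℝ → ℝ → Plane) (p q : ℂ), 0 < p.re ∧ q.re = 0 ∧ IsHomotopy C ∧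
      (∀ u, C 0 u = P + toPlane (∫ x in (0 : ℝ)..u, ((e₀ x : ℂ) + Complex.I * f₀ x) ^ 2)) ∧
      (∀ u, C 1 u = P + toPlane (∫ x in (0 : ℝ)..u, (p * e₁ x + q * f₁ x) ^ 2)) ∧
      lenH1 lam C ≤ ((2 * ENNReal.ofReal (5 * K) * ∫⁻ u in Ioc 0 (2 * Real.pi),
          ENNReal.ofReal (30 * K / κ * η + 3 * (|e₁ u - e₀ u| + |f₁ u - f₀ u|))) ^ 2 +
        ENNReal.ofReal lam * ((ENNReal.ofReal (5 * K) ^ 2 * ENNReal.ofReal (2 * Real.pi)) *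
          (4 * ∫⁻ u in Ioc 0 (2 * Real.pi), ENNReal.ofReal
            (30 * K / κ * η + 3 * (|e₁ u - e₀ u| + |f₁ u - f₀ u|)) ^ 2))) ^ (1 / 2 : ℝ) := by
  have hK : 0 ≤ K := (abs_nonneg _).trans (he₀K 0)
  set d : ℝ → ℝ := fun u => e₁ u - e₀ u with hd
  set g : ℝ → ℝ := fun u => f₁ u - f₀ u with hg
  have hdm : Measurable d := he₁.sub he₀
  have hgm : Measurable g := hf₁.sub hf₀
  have hdK : ∀ u, |d u| ≤ 2 * K := fun u => by
    linarith [abs_sub (e₁ u) (e₀ u), he₀K u, he₁K u]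
  have hgK : ∀ u, |g u| ≤ 2 * K := fun u => by
    linarith [abs_sub (f₁ u) (f₀ u), hf₀K u, hf₁K u]
  have hdint : IntervalIntegrable (fun u => |d u| + |g u|) volume 0 (2 * Real.pi) :=
    intervalIntegrable_of_locallyIntegrable (locallyIntegrable_of_bounded (B := 2 * K + 2 * K)
      (hdm.norm.add hgm.norm).aestronglyMeasurable fun u => by
        refine (norm_add_le _ _).trans (add_le_add ?_ ?_) <;> simp [hdK, hgK]) _ _
  have hη0 : 0 ≤ η := hη ▸ mul_nonneg (by linarith) (intervalIntegral.integral_nonneg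
    Real.two_pi_pos.le fun u _ => by positivity)
  -- coefficients of the Gram matrix along the segment
  have bound : ∀ {a b : ℝ → ℝ}, (∀ u, |a u * b u| ≤ 2 * K * (|d u| + |g u|)) → |ip a b| ≤ η :=
    fun h => hη ▸ abs_ip_le hdint h
  have bound2 : ∀ {a b a' b' : ℝ → ℝ}, (∀ u, |a u * b u| ≤ K * (|d u| + |g u|)) →
      (∀ u, |a' u * b' u| ≤ K * (|d u| + |g u|)) → |ip a b + ip a' b'| ≤ η := fun h h' => by
    have h1 := abs_ip_le hdint h
    have h2 := abs_ip_le hdint h'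
    exact (abs_add_le _ _).trans (by linarith)
  have mulb : ∀ {x y M N : ℝ}, |x| ≤ M → |y| ≤ N → |x * y| ≤ M * N := fun hx hy => by
    rw [abs_mul]
    exact mul_le_mul hx hy (abs_nonneg _) ((abs_nonneg _).trans hx)
  have mulb' : ∀ {x y M N : ℝ}, |x| ≤ M → |y| ≤ N → |y * x| ≤ M * N := fun hx hy => by
    rw [mul_comm]
    exact mulb hx hy
  have hd1 : ∀ u, |d u| ≤ |d u| + |g u| := fun u => le_add_of_nonneg_right (abs_nonneg _)
  have hg1 : ∀ u, |g u| ≤ |d u| + |g u| := fun u => le_add_of_nonneg_left (abs_nonneg _)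
  set E : ℝ → ℝ := fun t => ip (fun u => e₀ u + t * d u) (fun u => e₀ u + t * d u) with hEdef
  set F : ℝ → ℝ := fun t => ip (fun u => e₀ u + t * d u) (fun u => f₀ u + t * g u) with hFdef
  set H : ℝ → ℝ := fun t => ip (fun u => f₀ u + t * g u) (fun u => f₀ u + t * g u) with hHdef
  have hEt : ∀ t, E t = κ + ((ip e₀ d + ip d e₀) * t + ip d d * t ^ 2) := fun t => by
    rw [← hE]; exact ip_line he₀ he₀ hdm hdm he₀K he₀K hdK hdK t
  have hFt : ∀ t, F t = 0 + ((ip e₀ g + ip d f₀) * t + ip d g * t ^ 2) := fun t => by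
    rw [← hF]; exact ip_line he₀ hf₀ hdm hgm he₀K hf₀K hdK hgK t
  have hHt : ∀ t, H t = κ + ((ip f₀ g + ip g f₀) * t + ip g g * t ^ 2) := fun t => by
    rw [← hH]; exact ip_line hf₀ hf₀ hgm hgm hf₀K hf₀K hgK hgK t
  have be₁ : |ip e₀ d + ip d e₀| ≤ η := bound2 (fun u => mulb (he₀K u) (hd1 u))
    fun u => mulb' (he₀K u) (hd1 u)
  have be₂ : |ip d d| ≤ η := bound fun u => mulb (hdK u) (hd1 u)
  have bf₁ : |ip e₀ g + ip d f₀| ≤ η := bound2 (fun u => mulb (he₀K u) (hg1 u))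
    fun u => mulb' (hf₀K u) (hd1 u)
  have bf₂ : |ip d g| ≤ η := bound fun u => mulb (hdK u) (hg1 u)
  have bh₁ : |ip f₀ g + ip g f₀| ≤ η := bound2 (fun u => mulb (hf₀K u) (hg1 u))
    fun u => mulb' (hf₀K u) (hg1 u)
  have bh₂ : |ip g g| ≤ η := bound fun u => mulb (hgK u) (hg1 u)
  obtain ⟨D, hDc, hD0, hD, hD'⟩ := exists_sqrt_gram hκ hηκ be₁ be₂ bf₁ bf₂ bh₁ bh₂
  simp only [← hEt, ← hFt, ← hHt] at hD
  have hE' : ∀ t, HasDerivAt E (ip e₀ d + ip d e₀ + 2 * ip d d * t) t := fun t => by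
    rw [show E = _ from funext hEt]; exact hasDerivAt_quadratic _ _ _ _
  have hF' : ∀ t, HasDerivAt F (ip e₀ g + ip d f₀ + 2 * ip d g * t) t := fun t => by
    rw [show F = _ from funext hFt]; exact hasDerivAt_quadratic _ _ _ _
  have hEc : ContDiff ℝ 1 E := by rw [show E = _ from funext hEt]; fun_prop
  have hFc : ContDiff ℝ 1 F := by rw [show F = _ from funext hFt]; fun_prop
  have hEb : ∀ t ∈ Icc (0 : ℝ) 1, 0 < E t ∧ E t ≤ 2 * κ := fun t ht => by
    have := abs_le.1 (abs_quadratic_le be₁ be₂ ht)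
    rw [hEt]
    constructor <;> linarith [this.1, this.2]
  have hFb : ∀ t ∈ Icc (0 : ℝ) 1, |F t| ≤ κ := fun t ht => by
    have := abs_quadratic_le bf₁ bf₂ ht
    rw [hFt, zero_add]
    linarith
  have hF0 : F 0 = 0 := by simp [hFt]
  have hE0 : E 0 = κ := by simp [hEt]
  -- the path of square roots
  set p : ℝ → ℂ := fun t => ((D t : ℂ) - Complex.I * F t) / κ with hp
  set q : ℝ → ℂ := fun t => Complex.I * E t / κ with hq
  -- Expanding `p (e₀ + t d) + q (f₀ + t g)` separates the variables into four terms.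
  set a : Fin 4 → ℝ → ℂ := ![p, q, fun t => t * p t, fun t => t * q t] with ha
  set Y : Fin 4 → ℝ → ℂ := ![fun u => e₀ u, fun u => f₀ u, fun u => d u, fun u => g u] with hYdef
  have hy : ∀ t u, sepSum a Y t u = p t * ((e₀ u + t * d u : ℝ) : ℂ) +
      q t * ((f₀ u + t * g u : ℝ) : ℂ) := fun t u => by
    simp only [sepSum, Fin.sum_univ_four, ha, hYdef, Matrix.cons_val]
    push_cast
    ring
  have hYm : ∀ j, Measurable (Y j) := by
    intro j
    fin_cases j
    exacts [Complex.measurable_ofReal.comp he₀, Complex.measurable_ofReal.comp hf₀,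
      Complex.measurable_ofReal.comp hdm, Complex.measurable_ofReal.comp hgm]
  have hYB : ∀ j u, ‖Y j u‖ ≤ 2 * K := by
    intro j u
    fin_cases j
    · refine (Complex.norm_real _).trans_le ?_
      exact (he₀K u).trans (by linarith)
    · refine (Complex.norm_real _).trans_le ?_
      exact (hf₀K u).trans (by linarith)
    · exact (Complex.norm_real _).trans_le (hdK u)
    · exact (Complex.norm_real _).trans_le (hgK u)
  have hpc : ContDiffOn ℝ 1 p (Icc 0 1) := by
    have h1 : ContDiffOn ℝ 1 (fun t => (D t : ℂ)) (Icc 0 1) :=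
      Complex.ofRealCLM.contDiff.comp_contDiffOn hDc
    have h2 : ContDiff ℝ 1 (fun t => (F t : ℂ)) := Complex.ofRealCLM.contDiff.comp hFc
    exact (h1.sub (contDiff_const.mul h2).contDiffOn).div_const _
  have hqc : ContDiffOn ℝ 1 q (Icc 0 1) := by
    have h2 : ContDiff ℝ 1 (fun t => (E t : ℂ)) := Complex.ofRealCLM.contDiff.comp hEc
    exact ((contDiff_const.mul h2).div_const _).contDiffOn
  have htc : ContDiffOn ℝ 1 (fun t : ℝ => (t : ℂ)) (Icc 0 1) :=
    Complex.ofRealCLM.contDiff.contDiffOn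
  have hac : ∀ j, ContDiffOn ℝ 1 (a j) (Icc 0 1) := by
    intro j
    fin_cases j
    exacts [hpc, hqc, htc.mul hpc, htc.mul hqc]
  have heK : ∀ t ∈ Icc (0 : ℝ) 1, ∀ u, |e₀ u + t * d u| ≤ K := fun t ht u => by
    have h0 := abs_le.1 (he₀K u)
    have h1 := abs_le.1 (he₁K u)
    rw [hd, abs_le]
    constructor <;> nlinarith [ht.1, ht.2]
  have hfK : ∀ t ∈ Icc (0 : ℝ) 1, ∀ u, |f₀ u + t * g u| ≤ K := fun t ht u => by
    have h0 := abs_le.1 (hf₀K u)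
    have h1 := abs_le.1 (hf₁K u)
    rw [hg, abs_le]
    constructor <;> nlinarith [ht.1, ht.2]
  have hem : ∀ t : ℝ, Measurable fun u => e₀ u + t * d u := fun t => he₀.add (hdm.const_mul t)
  have hfm : ∀ t : ℝ, Measurable fun u => f₀ u + t * g u := fun t => hf₀.add (hgm.const_mul t)
  have hper : ∀ t ∈ Icc (0 : ℝ) 1,
      Function.Periodic (fun u => sepSum a Y t u ^ 2) (2 * Real.pi) := fun t _ u => by
    simp only [hy, hd, hg, he₀p u, hf₀p u, he₁p u, hf₁p u]
  have hκC : (κ : ℂ) ≠ 0 := by exact_mod_cast hκ.ne'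
  have hint : ∀ t ∈ Icc (0 : ℝ) 1,
      ∫ u in (0 : ℝ)..2 * Real.pi, sepSum a Y t u ^ 2 = 0 := fun t ht => by
    simp only [hy]
    refine (integral_sq_add (hem t) (hfm t) (heK t ht) (hfK t ht) (p t) (q t)).trans ?_
    have h2 : (D t : ℂ) ^ 2 = E t * H t - F t ^ 2 := by exact_mod_cast (hD t ht).2.2
    change p t ^ 2 * (E t : ℂ) + 2 * p t * q t * (F t : ℂ) + q t ^ 2 * (H t : ℂ) = 0
    simp only [hp, hq]
    field_simp
    -- The terms in `D F` cancel and `I ^ 2 = -1` leaves `E (D ^ 2 + F ^ 2 - E H)`.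
    linear_combination (E t : ℂ) * h2 + (E t * F t ^ 2 + E t ^ 2 * H t - 2 * E t * F t ^ 2 : ℂ) * Complex.I_sq
  have hyne : ∀ t ∈ Icc (0 : ℝ) 1, (∀ᵐ u, sepSum a Y t u ≠ 0) ∨
      ((t = 0 ∨ t = 1) ∧ ∀ u, sepSum a Y t u = 0) := fun t ht => by
    left
    filter_upwards [hne] with u hu h0
    rw [hy] at h0
    simp only [hp, hq] at h0
    rw [div_mul_eq_mul_div, div_mul_eq_mul_div, ← add_div, div_eq_zero_iff, or_iff_left hκC] at h0
    have hre := congrArg Complex.re h0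
    have him := congrArg Complex.im h0
    simp at hre him
    -- The real part is `D / κ > 0` times the interpolated `e`. For `t > 0` that interpolation is
    -- positive, since `e₀ ≥ 0` and `e₁ > 0`; only `t = 0` needs `hne`.
    have h1 : e₀ u + t * d u = 0 := hre.resolve_left (hD t ht).1.ne'
    rw [h1] at him
    have h2 : f₀ u + t * g u = 0 := by
      simpa [(hEb t ht).1.ne'] using him
    rcases ht.1.eq_or_lt with rfl | htpos
    · simp at h1 h2
      exact hu.elim (fun h => h h1) (fun h => h h2)
    · rw [hd] at h1
      nlinarith [he₀0 u, he₁0 u, mul_pos htpos (he₁0 u), mul_nonneg (sub_nonneg.2 ht.2) (he₀0 u)]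
  have hpn : ∀ t ∈ Icc (0 : ℝ) 1, ‖p t‖ ≤ 3 := fun t ht => by
    simp only [hp]
    rw [norm_div, Complex.norm_real, Real.norm_of_nonneg hκ.le, div_le_iff₀ hκ]
    refine (norm_sub_le _ _).trans ?_
    rw [norm_mul, Complex.norm_I, one_mul, Complex.norm_real, Complex.norm_real,
      Real.norm_of_nonneg (hD t ht).1.le, Real.norm_eq_abs]
    linarith [(hD t ht).2.1, hFb t ht]
  have hqn : ∀ t ∈ Icc (0 : ℝ) 1, ‖q t‖ ≤ 2 := fun t ht => by
    simp only [hq]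
    rw [norm_div, Complex.norm_real, Real.norm_of_nonneg hκ.le, div_le_iff₀ hκ,
      norm_mul, Complex.norm_I, one_mul, Complex.norm_real, Real.norm_of_nonneg (hEb t ht).1.le]
    exact (hEb t ht).2
  refine ⟨squareHomotopy P (sepSum a Y), p 1, q 1, ?_, ?_,
    isHomotopy_squareHomotopy hYm hYB hac P hper hint hyne, fun u => ?_, fun u => ?_,
    lenH1_squareHomotopy_le hYm hYB hac P lam ENNReal.ofReal_ne_top (fun t ht u => ?_)
      (fun t ht u => ?_)⟩
  · have : (p 1).re = D 1 / κ := by simp [hp]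
    rw [this]
    exact div_pos (hD 1 (by simp)).1 hκ
  · simp [hq]
  · simp only [squareHomotopy, hy]
    simp [hp, hq, hD0, hF0, hE0, hκC]
  · simp only [squareHomotopy, hy]
    simp [hd, hg]
  · have ht' := Ioo_subset_Icc_self ht
    rw [← ofReal_norm]
    refine ENNReal.ofReal_le_ofReal ?_
    rw [hy]
    refine (norm_add_le _ _).trans ?_
    rw [norm_mul, norm_mul, Complex.norm_real, Complex.norm_real]
    have h1 := mul_le_mul (hpn t ht') (heK t ht' u) (abs_nonneg _) (by norm_num)
    have h2 := mul_le_mul (hqn t ht') (hfK t ht' u) (abs_nonneg _) (by norm_num)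
    simp only [Real.norm_eq_abs]
    linarith
  · have ht' := Ioo_subset_Icc_self ht
    have hDd : HasDerivAt D (deriv D t) t :=
      ((hDc.differentiableOn one_ne_zero).differentiableAt (Icc_mem_nhds ht.1 ht.2)).hasDerivAt
    set F' := ip e₀ g + ip d f₀ + 2 * ip d g * t with hF'def
    set E' := ip e₀ d + ip d e₀ + 2 * ip d d * t with hE'def
    have hpd : HasDerivAt p (((deriv D t : ℝ) - Complex.I * (F' : ℝ)) / κ) t :=
      (hDd.ofReal_comp.sub ((hF' t).ofReal_comp.const_mul Complex.I)).div_const _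
    have hqd : HasDerivAt q (Complex.I * (E' : ℝ) / κ) t :=
      ((hE' t).ofReal_comp.const_mul Complex.I).div_const _
    have hid : HasDerivAt (fun t : ℝ => (t : ℂ)) 1 t := (hasDerivAt_id t).ofReal_comp
    have hF'b : |F'| ≤ 3 * η := abs_deriv_quadratic_le bf₁ bf₂ ht'
    have hE'b : |E'| ≤ 3 * η := abs_deriv_quadratic_le be₁ be₂ ht'
    -- The bound `27` is `24` from `D` plus `3` from `F`; with `3` from `q` it produces the `30` in
    -- the statement, while `3 * (|d| + |g|)` comes from differentiating the segment.
    have hpd' : ‖deriv p t‖ ≤ 27 * η / κ := by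
      rw [hpd.deriv, norm_div, Complex.norm_real, Real.norm_of_nonneg hκ.le]
      gcongr
      refine (norm_sub_le _ _).trans ?_
      rw [norm_mul, Complex.norm_I, one_mul, Complex.norm_real, Complex.norm_real,
        Real.norm_eq_abs, Real.norm_eq_abs]
      linarith [hD' t ht]
    have hqd' : ‖deriv q t‖ ≤ 3 * η / κ := by
      rw [hqd.deriv, norm_div, Complex.norm_real, Real.norm_of_nonneg hκ.le]
      gcongr
      rw [norm_mul, Complex.norm_I, one_mul, Complex.norm_real, Real.norm_eq_abs]
      exact hE'b
    have hy' : sepSum (fun j => deriv (a j)) Y t u =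
        deriv p t * ((e₀ u + t * d u : ℝ) : ℂ) + deriv q t * ((f₀ u + t * g u : ℝ) : ℂ) +
          (p t * d u + q t * g u) := by
      have e2 : deriv (fun t : ℝ => (t : ℂ) * p t) t = p t + t * deriv p t := by
        simpa using (hid.fun_mul hpd.differentiableAt.hasDerivAt).deriv
      have e3 : deriv (fun t : ℝ => (t : ℂ) * q t) t = q t + t * deriv q t := by
        simpa using (hid.fun_mul hqd.differentiableAt.hasDerivAt).deriv
      simp only [sepSum, Fin.sum_univ_four, ha, hYdef, Matrix.cons_val, e2, e3]
      push_cast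
      ring
    rw [← ofReal_norm]
    refine ENNReal.ofReal_le_ofReal ?_
    rw [hy']
    refine (norm_add_le _ _).trans (add_le_add ((norm_add_le _ _).trans ?_)
      ((norm_add_le _ _).trans ?_))
    · rw [norm_mul, norm_mul, Complex.norm_real, Complex.norm_real]
      have h1 := mul_le_mul hpd' (heK t ht' u) (abs_nonneg _) (by positivity)
      have h2 := mul_le_mul hqd' (hfK t ht' u) (abs_nonneg _) (by positivity)
      refine (add_le_add h1 h2).trans_eq ?_
      ring
    · rw [norm_mul, norm_mul, Complex.norm_real, Complex.norm_real]
      have h1 := mul_le_mul_of_nonneg_right (hpn t ht') (abs_nonneg (d u))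
      have h2 := mul_le_mul_of_nonneg_right (hqn t ht') (abs_nonneg (g u))
      simp only [Real.norm_eq_abs]
      linarith [abs_nonneg (g u)]

/-! ### Mollification with preserved bounds -/

open scoped Convolution in
/-- Periodic bounded functions are almost everywhere limits of smooth ones with the same bounds. -/
theorem exists_smooth_approx {f : ℝ → ℝ} {K T : ℝ} (hf : Measurable f) (hK : ∀ u, |f u| ≤ K)
    (hper : Function.Periodic f T) :
    ∃ F : ℕ → ℝ → ℝ, (∀ n, ContDiff ℝ ∞ (F n)) ∧ (∀ n, Function.Periodic (F n) T) ∧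
      (∀ n u, |F n u| ≤ K) ∧ ((∀ u, 0 ≤ f u) → ∀ n u, 0 ≤ F n u) ∧
      ∀ᵐ u, Tendsto (fun n => F n u) atTop (𝓝 (f u)) := by
  let φ : ℕ → ContDiffBump (0 : ℝ) := fun n =>
    ⟨1 / ((n : ℝ) + 1), 2 * (1 / ((n : ℝ) + 1)), by positivity,
      by linarith [show (0 : ℝ) < 1 / ((n : ℝ) + 1) by positivity]⟩
  have hloc : LocallyIntegrable f volume := locallyIntegrable_of_bounded hf.aestronglyMeasurable hK
  have hK0 : 0 ≤ K := (abs_nonneg _).trans (hK 0)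
  refine ⟨fun n => (φ n).normed volume ⋆[ContinuousLinearMap.lsmul ℝ ℝ, volume] f, fun n => ?_,
    fun n u => ?_, fun n u => ?_, fun h n u => ?_, ?_⟩
  · exact (φ n).hasCompactSupport_normed.contDiff_convolution_left _ (φ n).contDiff_normed hloc
  · simp only [convolution_def]
    refine integral_congr_ae (Eventually.of_forall fun t => ?_)
    simp only [show u + T - t = u - t + T by ring, hper (u - t)]
  · have h := dist_convolution_le (μ := volume) (g := f) (x₀ := u) (z₀ := (0 : ℝ)) hK0
      (φ n).support_normed_eq.subset (φ n).nonneg_normed (φ n).integral_normed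
      hf.aestronglyMeasurable (fun x _ => by simpa using hK x)
    simpa using h
  · simp only [convolution_def]
    refine integral_nonneg fun t => ?_
    simpa using mul_nonneg ((φ n).nonneg_normed t) (h _)
  -- Lebesgue differentiation applies because the outer radius of each bump is exactly twice the
  -- inner one.
  · refine ContDiffBump.ae_convolution_tendsto_right_of_locallyIntegrable (K := 2) ?_ ?_ hloc
    · simpa [φ] using (tendsto_one_div_add_atTop_nhds_zero_nat (𝕜 := ℝ)).const_mul 2
    · exact Eventually.of_forall fun n => le_rfl

/-! ### Smooth immersed curves close to a given curve -/

theorem SameGeometricCurve.refl {c : ℝ → Plane} (hc : IsClosedCurve c) : SameGeometricCurve c c :=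
  ⟨c, id, id, hc, ⟨continuous_id, monotone_id, fun _ => rfl⟩,
    ⟨continuous_id, monotone_id, fun _ => rfl⟩, rfl, rfl⟩

theorem isSmoothImmersed_of_sq {c : ℝ → Plane} {w : ℝ → ℂ} {P : Plane} (hw : ContDiff ℝ ∞ w)
    (hw0 : ∀ u, w u ≠ 0) (hc : ∀ u, c u = P + toPlane (∫ x in (0 : ℝ)..u, w x ^ 2))
    (hper : Function.Periodic c (2 * Real.pi)) : IsSmoothImmersed c := by
  have hd : ∀ u, HasDerivAt c (toPlane (w u ^ 2)) u := fun u => by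
    have h1 : HasDerivAt (fun u => ∫ x in (0 : ℝ)..u, w x ^ 2) (w u ^ 2) u :=
      (hw.continuous.pow 2).integral_hasStrictDerivAt 0 u |>.hasDerivAt
    rw [show c = _ from funext hc]
    exact (toPlane.toContinuousLinearEquiv.hasFDerivAt.comp_hasDerivAt u h1).const_add P
  have hsm : ContDiff ℝ ∞ c := by
    rw [contDiff_infty_iff_deriv]
    refine ⟨fun u => (hd u).differentiableAt, ?_⟩
    rw [show deriv c = _ from funext fun u => (hd u).deriv]
    exact toPlane.toContinuousLinearEquiv.contDiff.comp (hw.pow 2)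
  refine ⟨⟨hsm.continuous, hper⟩, hsm, fun u => ?_⟩
  rw [(hd u).deriv]
  simpa using hw0 u

theorem tendsto_lenH1_bound {x y : ℕ → ℝ≥0∞} (hx : Tendsto x atTop (𝓝 0))
    (hy : Tendsto y atTop (𝓝 0)) {K M : ℝ≥0∞} (hK : K ≠ ⊤) (hM : M ≠ ⊤) (lam : ℝ) :
    Tendsto (fun n => ((2 * K * x n) ^ 2 + ENNReal.ofReal lam * ((K ^ 2 * M) *
      (4 * y n))) ^ (1 / 2 : ℝ)) atTop (𝓝 0) := by
  have h1 : Tendsto (fun n => (2 * K * x n) ^ 2) atTop (𝓝 0) := by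
    simpa using ENNReal.Tendsto.pow (n := 2) (ENNReal.Tendsto.const_mul hx
      (Or.inr (by finiteness : 2 * K ≠ ⊤)))
  have h2 : Tendsto (fun n => ENNReal.ofReal lam * ((K ^ 2 * M) * (4 * y n))) atTop (𝓝 0) := by
    simpa using ENNReal.Tendsto.const_mul (a := ENNReal.ofReal lam) (ENNReal.Tendsto.const_mul
      (a := K ^ 2 * M) (ENNReal.Tendsto.const_mul (a := 4) hy (Or.inr (by simp)))
        (Or.inr (by finiteness))) (Or.inr (by simp))
  have h3 := (h1.add h2).ennrpow_const (1 / 2 : ℝ)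
  simpa using h3

theorem distH1_le {lam : ℝ} {c₀ c₁ : ℝ → Plane} {C : ℝ → ℝ → Plane} (hC : IsHomotopy C)
    (h₀ : SameGeometricCurve c₀ (C 0)) (h₁ : SameGeometricCurve (C 1) c₁) :
    distH1 lam c₀ c₁ ≤ lenH1 lam C :=
  iInf₂_le C ⟨hC, h₀, h₁⟩

/-- The homotopy grows from the point `P` to a small circle through `P`. Its root is `t * w` with
`w` of constant norm `δ`, so its length tends to `0` with `δ`. -/
theorem exists_approx_of_const (lam : ℝ) (P : Plane) {ε : ℝ≥0∞} (hε : 0 < ε) :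
    ∃ c' : ℝ → Plane, IsSmoothImmersed c' ∧ distH1 lam (fun _ => P) c' ≤ ε := by
  have hlim : Tendsto (fun n : ℕ => ENNReal.ofReal (1 / ((n : ℝ) + 1))) atTop (𝓝 0) := by
    simpa using ENNReal.tendsto_ofReal (tendsto_one_div_add_atTop_nhds_zero_nat (𝕜 := ℝ))
  have hx : Tendsto (fun n : ℕ => ∫⁻ u in Ioc 0 (2 * Real.pi), ENNReal.ofReal (1 / ((n : ℝ) + 1)))
      atTop (𝓝 0) := by
    simp only [setLIntegral_const]
    simpa using ENNReal.Tendsto.mul_const (b := volume (Ioc 0 (2 * Real.pi))) hlim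
      (Or.inr (by simp [ENNReal.mul_eq_top]))
  have hy : Tendsto (fun n : ℕ => ∫⁻ u in Ioc 0 (2 * Real.pi),
      ENNReal.ofReal (1 / ((n : ℝ) + 1)) ^ 2) atTop (𝓝 0) := by
    simp only [setLIntegral_const]
    simpa using ENNReal.Tendsto.mul_const (b := volume (Ioc 0 (2 * Real.pi))) (ENNReal.Tendsto.pow (n := 2) hlim)
      (Or.inr (by simp [ENNReal.mul_eq_top]))
  obtain ⟨n, hn⟩ := ((tendsto_lenH1_bound hx hy ENNReal.one_ne_top
    (ENNReal.ofReal_ne_top (r := 2 * Real.pi)) lam).eventually_le_const hε).exists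
  set δ : ℝ := 1 / ((n : ℝ) + 1) with hδ
  have hδ0 : 0 < δ := by positivity
  have hδ1 : δ ≤ 1 := by
    rw [hδ, div_le_one (by positivity)]
    linarith [Nat.cast_nonneg (α := ℝ) n]
  -- The half angle makes `w` antiperiodic, but only its square, a full turn of the circle, must be
  -- periodic.
  set w : ℝ → ℂ := fun u => δ * Complex.exp (u / 2 * Complex.I) with hw
  set a : Fin 1 → ℝ → ℂ := fun _ t => t with ha
  set Y : Fin 1 → ℝ → ℂ := fun _ => w with hY
  have hwn : ∀ u, ‖w u‖ = δ := fun u => by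
    rw [hw, norm_mul, Complex.norm_real, Real.norm_of_nonneg hδ0.le]
    have : (u / 2 * Complex.I : ℂ) = ((u / 2 : ℝ) : ℂ) * Complex.I := by push_cast; ring
    rw [this, Complex.norm_exp_ofReal_mul_I, mul_one]
  have hws : ContDiff ℝ ∞ w := by
    have h1 : ContDiff ℝ ∞ fun u : ℝ => (u : ℂ) := Complex.ofRealCLM.contDiff
    exact contDiff_const.mul (((h1.div_const 2).mul contDiff_const).cexp)
  have hsep : ∀ t u, sepSum a Y t u = t * w u := fun t u => by simp [sepSum, ha, hY]
  have hsq : ∀ t u, sepSum a Y t u ^ 2 = (t * δ) ^ 2 * Complex.exp (Complex.I * u) := fun t u => by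
    rw [hsep, hw, mul_pow, mul_pow, mul_pow, ← Complex.exp_nat_mul]
    rw [show ((2 : ℕ) : ℂ) * (u / 2 * Complex.I) = Complex.I * u by push_cast; ring]
    ring
  have hYm : ∀ j, Measurable (Y j) := fun _ => hws.continuous.measurable
  have hYB : ∀ j u, ‖Y j u‖ ≤ δ := fun _ u => (hwn u).le
  have hac : ∀ j, ContDiffOn ℝ 1 (a j) (Icc 0 1) := fun _ => Complex.ofRealCLM.contDiff.contDiffOn
  have hH : IsHomotopy (squareHomotopy P (sepSum a Y)) := by
    refine isHomotopy_squareHomotopy hYm hYB hac P (fun t _ u => ?_) (fun t _ => ?_) fun t ht => ?_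
    · simp only [hsq]
      congr 1
      rw [show Complex.I * ((u + 2 * Real.pi : ℝ) : ℂ) = Complex.I * u + 2 * Real.pi * Complex.I by
        push_cast; ring, Complex.exp_periodic]
    · simp only [hsq]
      rw [intervalIntegral.integral_const_mul, integral_exp_mul_complex Complex.I_ne_zero]
      simp [show Complex.I * (2 * Real.pi) = 2 * Real.pi * Complex.I by ring]
    · rcases eq_or_ne t 0 with rfl | h0
      · exact Or.inr ⟨Or.inl rfl, fun u => by simp [hsep]⟩
      · refine Or.inl (Eventually.of_forall fun u => ?_)
        rw [hsep]
        refine mul_ne_zero (by exact_mod_cast h0) ?_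
        rw [← norm_pos_iff, hwn]
        exact hδ0
  have hsm : IsSmoothImmersed (squareHomotopy P (sepSum a Y) 1) := by
    refine isSmoothImmersed_of_sq hws (fun u => ?_) (fun u => ?_) (hH.1.1 1 (by simp)) (P := P)
    · rw [← norm_pos_iff, hwn]
      exact hδ0
    · simp [squareHomotopy, hsep]
  refine ⟨_, hsm, (distH1_le hH ?_ (SameGeometricCurve.refl hsm.1)).trans (le_trans ?_ hn)⟩
  · have : squareHomotopy P (sepSum a Y) 0 = fun _ => P := funext fun u => by
      simp [squareHomotopy, hsep]
    rw [this]
    exact SameGeometricCurve.refl ⟨continuous_const, fun _ => rfl⟩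
  · refine lenH1_squareHomotopy_le hYm hYB hac P lam ENNReal.one_ne_top (fun t ht u => ?_)
      fun t ht u => ?_
    · rw [hsep, ← ofReal_norm, ENNReal.ofReal_le_one, norm_mul, hwn, Complex.norm_real,
        Real.norm_of_nonneg ht.1.le]
      exact mul_le_one₀ ht.2.le hδ0.le hδ1
    · have : deriv (fun t : ℝ => (t : ℂ)) t = 1 := ((hasDerivAt_id t).ofReal_comp).deriv
      simp only [sepSum, ha, hY, this]
      rw [← ofReal_norm]
      simp [hwn]

theorem exists_approx_of_constantSpeed (lam : ℝ) {γ : ℝ → Plane} {κ : ℝ} (hκ : 0 < κ)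
    (hγ : IsClosedCurve γ) (hint : ∀ u, γ u = γ 0 + ∫ x in (0 : ℝ)..u, deriv γ x)
    (hle : ∀ u, ‖deriv γ u‖ ≤ κ) (hae : ∀ᵐ u, ‖deriv γ u‖ = κ) {ε : ℝ≥0∞} (hε : 0 < ε) :
    ∃ (c' : ℝ → Plane) (C : ℝ → ℝ → Plane), IsSmoothImmersed c' ∧ IsHomotopy C ∧ C 0 = γ ∧
      C 1 = c' ∧ lenH1 lam C ≤ ε := by
  -- a square root of the velocity with nonnegative real part
  set z : ℝ → ℂ := fun u => (toPlane.symm (deriv γ u)) ^ (2⁻¹ : ℂ) with hz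
  have hzsq : ∀ u, z u ^ 2 = toPlane.symm (deriv γ u) := fun u => by
    exact_mod_cast Complex.cpow_nat_inv_pow (toPlane.symm (deriv γ u)) two_ne_zero
  have hzn : ∀ u, ‖z u‖ ^ 2 = ‖deriv γ u‖ := fun u => by
    rw [← norm_pow, hzsq, LinearIsometryEquiv.norm_map]
  have hzm : Measurable z :=
    ((toPlane.symm.continuous.measurable.comp (measurable_deriv γ)).pow_const _)
  -- The root is chosen pointwise, so it inherits the period of the velocity; its jumps across the
  -- branch cut are harmless, as only measurability and boundedness are needed.
  have hzp : Function.Periodic z (2 * Real.pi) := fun u => by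
    have : deriv γ (u + 2 * Real.pi) = deriv γ u := by
      rw [← deriv_comp_add_const, show (fun x => γ (x + 2 * Real.pi)) = γ from funext hγ.2]
    simp only [hz, this]
  have hzK : ∀ u, ‖z u‖ ≤ √κ := fun u => Real.le_sqrt_of_sq_le ((hzn u).trans_le (hle u))
  set e₀ : ℝ → ℝ := fun u => (z u).re with he₀
  set f₀ : ℝ → ℝ := fun u => (z u).im with hf₀
  have hzef : ∀ u, z u = e₀ u + Complex.I * f₀ u := fun u => by
    rw [mul_comm]; exact (Complex.re_add_im (z u)).symm
  have he₀m : Measurable e₀ := Complex.measurable_re.comp hzm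
  have hf₀m : Measurable f₀ := Complex.measurable_im.comp hzm
  have he₀K : ∀ u, |e₀ u| ≤ √κ := fun u => (Complex.abs_re_le_norm _).trans (hzK u)
  have hf₀K : ∀ u, |f₀ u| ≤ √κ := fun u => (Complex.abs_im_le_norm _).trans (hzK u)
  have he₀p : Function.Periodic e₀ (2 * Real.pi) := fun u => by simp only [he₀, hzp u]
  have hf₀p : Function.Periodic f₀ (2 * Real.pi) := fun u => by simp only [hf₀, hzp u]
  have he₀0 : ∀ u, 0 ≤ e₀ u := fun u => by
    simp only [he₀, hz, Complex.cpow_inv_two_re]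
    positivity
  have hsqint : ∀ u, γ 0 + toPlane (∫ x in (0 : ℝ)..u, ((e₀ x : ℂ) + Complex.I * f₀ x) ^ 2) =
      γ u := fun u => by
    simp only [← hzef, hzsq]
    have h1 := toPlane.symm.toContinuousLinearEquiv.toContinuousLinearMap.intervalIntegral_comp_comm
      (intervalIntegrable_of_locallyIntegrable (locallyIntegrable_of_bounded
        (measurable_deriv γ).aestronglyMeasurable hle) 0 u)
    rw [hint u]
    congr 1
    refine (congrArg toPlane h1).trans ?_
    exact toPlane.apply_symm_apply _
  -- Closure of `γ` says that `∫ z ^ 2` over a period vanishes; its real and imaginary parts give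
  -- equal norms and orthogonality. Constant speed then fixes the common squared norm as `π κ`.
  have hclosed : (ip e₀ e₀ : ℂ) + 2 * Complex.I * ip e₀ f₀ - ip f₀ f₀ = 0 := by
    have h1 := integral_sq_add he₀m hf₀m he₀K hf₀K 1 Complex.I
    have h2 := hsqint (2 * Real.pi)
    rw [show γ (2 * Real.pi) = γ 0 by simpa using hγ.2 0, add_eq_left] at h2
    simp only [one_mul] at h1
    rw [(LinearIsometryEquiv.map_eq_zero_iff toPlane).1 h2] at h1
    linear_combination -h1 - (ip f₀ f₀ : ℂ) * Complex.I_sq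
  have hEH : ip e₀ e₀ = ip f₀ f₀ := by
    have := congrArg Complex.re hclosed
    simp at this
    linarith
  have hF : ip e₀ f₀ = 0 := by
    have := congrArg Complex.im hclosed
    simpa using this
  have hE : ip e₀ e₀ = Real.pi * κ := by
    have h1 : ip e₀ e₀ + ip f₀ f₀ = 2 * Real.pi * κ := by
      simp only [ip]
      rw [← intervalIntegral.integral_add
        (intervalIntegrable_mul_of_bounded he₀m he₀m he₀K he₀K _ _)
        (intervalIntegrable_mul_of_bounded hf₀m hf₀m hf₀K hf₀K _ _)]
      calc _ = ∫ u in (0 : ℝ)..2 * Real.pi, κ := by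
            refine intervalIntegral.integral_congr_ae ?_
            filter_upwards [hae] with u hu _
            rw [← hu, ← hzn, Complex.sq_norm, Complex.normSq_apply]
        _ = _ := by simp
    linarith
  have hne : ∀ᵐ u, e₀ u ≠ 0 ∨ f₀ u ≠ 0 := by
    filter_upwards [hae] with u hu
    by_contra! h
    have : z u = 0 := by rw [hzef, h.1, h.2]; simp
    rw [← hzn, this] at hu
    simp at hu
    exact hκ.ne hu
  -- smooth approximations of the square root
  obtain ⟨G, hGs, hGp, hGK, hG0, hGt⟩ := exists_smooth_approx he₀m he₀K he₀p
  obtain ⟨F, hFs, hFp, hFK, -, hFt⟩ := exists_smooth_approx hf₀m hf₀K hf₀p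
  -- Mollification only preserves nonnegativity; this shift makes the real component strictly
  -- positive.
  set s : ℕ → ℝ := fun n => 1 / ((n : ℝ) + 1) with hs
  have hs0 : ∀ n, 0 < s n := fun n => by positivity
  have hs1 : ∀ n, s n ≤ 1 := fun n => by
    simp only [hs]
    rw [div_le_one (by positivity)]
    linarith [Nat.cast_nonneg (α := ℝ) n]
  set K : ℝ := √κ + 1 with hK
  have hK0 : 0 < K := by positivity
  set d : ℕ → ℝ → ℝ := fun n u => |G n u + s n - e₀ u| + |F n u - f₀ u| with hd
  have hdm : ∀ n, Measurable (d n) := fun n =>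
    (((hGs n).continuous.measurable.add_const _).sub he₀m).norm.add
      ((hFs n).continuous.measurable.sub hf₀m).norm
  have hd0 : ∀ n u, 0 ≤ d n u := fun n u => by positivity
  have hGsK : ∀ n u, |G n u + s n| ≤ K := fun n u => by
    have := abs_add_le (G n u) (s n)
    rw [abs_of_pos (hs0 n)] at this
    linarith [hGK n u, hs1 n]
  have hdK : ∀ n u, d n u ≤ 4 * K := fun n u => by
    simp only [hd]
    linarith [abs_sub (G n u + s n) (e₀ u), abs_sub (F n u) (f₀ u), hGsK n u, he₀K u, hFK n u,
      hf₀K u]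
  have hdt : ∀ᵐ u, Tendsto (fun n => d n u) atTop (𝓝 0) := by
    filter_upwards [hGt, hFt] with u h1 h2
    have h3 := (((h1.add (tendsto_one_div_add_atTop_nhds_zero_nat (𝕜 := ℝ))).sub_const
      (e₀ u)).abs).add ((h2.sub_const (f₀ u)).abs)
    simpa [hd, hs] using h3
  set η : ℕ → ℝ := fun n => 2 * K * ∫ u in (0 : ℝ)..2 * Real.pi, d n u with hη
  -- Bounded almost everywhere convergence makes the segments short in `L¹`; the same argument below
  -- makes the integrals in the length bound tend to `0`.
  have hηt : Tendsto η atTop (𝓝 0) := by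
    have h1 : Tendsto (fun n => ∫ u in (0 : ℝ)..2 * Real.pi, d n u) atTop
        (𝓝 (∫ u in (0 : ℝ)..2 * Real.pi, (0 : ℝ))) :=
      intervalIntegral.tendsto_integral_filter_of_dominated_convergence (fun _ => 4 * K)
        (Eventually.of_forall fun n => (hdm n).aestronglyMeasurable)
        (Eventually.of_forall fun n => Eventually.of_forall fun u _ => by
          rw [Real.norm_of_nonneg (hd0 n u)]; exact hdK n u)
        intervalIntegrable_const (hdt.mono fun u hu _ => hu)
    simpa using h1.const_mul (2 * K)
  set A : ℝ := 30 * K / (Real.pi * κ) with hA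
  have hA0 : 0 ≤ A := by positivity
  have hgt : ∀ᵐ u ∂volume.restrict (Ioc 0 (2 * Real.pi)),
      Tendsto (fun n => ENNReal.ofReal (A * η n + 3 * d n u)) atTop (𝓝 0) := by
    refine ae_restrict_of_ae ?_
    filter_upwards [hdt] with u hu
    simpa using ENNReal.tendsto_ofReal ((hηt.const_mul A).add (hu.const_mul 3))
  obtain ⟨B, hB⟩ := hηt.bddAbove_range
  have hηB : ∀ n, η n ≤ B := fun n => hB ⟨n, rfl⟩
  have hgB : ∀ n u, ENNReal.ofReal (A * η n + 3 * d n u) ≤ ENNReal.ofReal (A * B + 3 * (4 * K)) :=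
    fun n u => ENNReal.ofReal_le_ofReal (add_le_add (mul_le_mul_of_nonneg_left (hηB n) hA0)
      (by linarith [hdK n u]))
  have hgm : ∀ n, Measurable fun u => ENNReal.ofReal (A * η n + 3 * d n u) := fun n =>
    (((hdm n).const_mul 3).const_add _).ennreal_ofReal
  have hx : Tendsto (fun n => ∫⁻ u in Ioc 0 (2 * Real.pi), ENNReal.ofReal (A * η n + 3 * d n u))
      atTop (𝓝 0) := by
    have := tendsto_lintegral_of_dominated_convergence (fun _ => ENNReal.ofReal (A * B + 3 * (4 * K)))
      hgm (fun n => Eventually.of_forall fun u => hgB n u) (by simp [ENNReal.mul_eq_top]) hgt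
    simpa using this
  have hy : Tendsto (fun n => ∫⁻ u in Ioc 0 (2 * Real.pi),
      ENNReal.ofReal (A * η n + 3 * d n u) ^ 2) atTop (𝓝 0) := by
    have := tendsto_lintegral_of_dominated_convergence
      (fun _ => ENNReal.ofReal (A * B + 3 * (4 * K)) ^ 2)
      (fun n => (hgm n).pow_const 2)
      (fun n => Eventually.of_forall fun u => pow_le_pow_left' (hgB n u) 2)
      (by simp [ENNReal.mul_eq_top])
      (hgt.mono fun u hu => by simpa using ENNReal.Tendsto.pow (n := 2) hu)
    simpa using this
  obtain ⟨n, hn, hηn⟩ := (((tendsto_lenH1_bound hx hy (ENNReal.ofReal_ne_top (r := 5 * K))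
    (ENNReal.ofReal_ne_top (r := 2 * Real.pi)) lam).eventually_le_const hε).and
    (hηt.eventually_le_const (show 0 < Real.pi * κ / 100 by positivity))).exists
  have hKle : √κ ≤ K := by linarith
  have hπκ : 0 < Real.pi * κ := by positivity
  obtain ⟨C, p, q, hp, hq, hC, hC0, hC1, hlen⟩ := exists_homotopy (e₁ := fun u => G n u + s n)
    (f₁ := F n) (K := K) (η := η n) he₀m hf₀m ((hGs n).continuous.measurable.add_const _)
    (hFs n).continuous.measurable (fun u => (he₀K u).trans hKle) (fun u => (hf₀K u).trans hKle)
    (hGsK n) (fun u => (hFK n u).trans hKle) he₀p hf₀p (fun u => by simp only [hGp n u]) (hFp n)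
    hπκ hE (hEH ▸ hE) hF rfl hηn he₀0
    (fun u => add_pos_of_nonneg_of_pos (hG0 he₀0 n u) (hs0 n)) hne (γ 0) lam
  refine ⟨C 1, C, ?_, hC, funext fun u => (hC0 u).trans (hsqint u), rfl, hlen.trans hn⟩
  refine isSmoothImmersed_of_sq (w := fun x => p * ((G n x + s n : ℝ) : ℂ) + q * F n x) ?_
    (fun u h => ?_) hC1 (hC.1.1 1 (by simp))
  · have h1 : ContDiff ℝ ∞ fun x => ((G n x + s n : ℝ) : ℂ) :=
      Complex.ofRealCLM.contDiff.comp ((hGs n).add contDiff_const)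
    have h2 : ContDiff ℝ ∞ fun x => ((F n x : ℝ) : ℂ) := Complex.ofRealCLM.contDiff.comp (hFs n)
    exact (contDiff_const.mul h1).add (contDiff_const.mul h2)
  · have hre := congrArg Complex.re h
    rw [Complex.add_re, Complex.re_mul_ofReal, Complex.re_mul_ofReal, hq, zero_mul, add_zero] at hre
    -- The real part of `w` is `p.re` times a positive function, as `q` is purely imaginary, so the
    -- end velocity never vanishes.
    exact (mul_pos hp (add_pos_of_nonneg_of_pos (hG0 he₀0 n u) (hs0 n))).ne' hre

theorem IsRectifiable.exists_approx (lam : ℝ) {c : ℝ → Plane} (hc : IsRectifiable c) {ε : ℝ≥0∞}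
    (hε : 0 < ε) : ∃ c' : ℝ → Plane, IsSmoothImmersed c' ∧ distH1 lam c c' ≤ ε := by
  rcases hc.exists_constantSpeed with h | ⟨γ, φ, κ, hκ, hγ, hφ, hcγ, hint, hle, hae⟩
  · rw [show c = fun _ => c 0 from funext h]
    exact exists_approx_of_const lam (c 0) hε
  · obtain ⟨c', C, hc', hC, hC0, hC1, hlen⟩ :=
      exists_approx_of_constantSpeed lam hκ hγ hint hle hae hε
    refine ⟨c', hc', (distH1_le hC ?_ ?_).trans hlen⟩
    -- The homotopy starts at the constant-speed curve `γ`; the possibly non-injective `φ` relates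
    -- it to `c`.
    · exact ⟨γ, φ, id, hγ, hφ, ⟨continuous_id, monotone_id, fun _ => rfl⟩, hcγ, hC0⟩
    · rw [hC1]
      exact SameGeometricCurve.refl hc'.1

end H1Curves

end

theorem mainTheorem3 (lam : ℝ) (hlam : 0 < lam) (c : ℝ → H1Curves.Plane)
    (hc : H1Curves.IsRectifiable c) :
    ∃ cn : ℕ → ℝ → H1Curves.Plane,
      (∀ n, H1Curves.IsSmoothImmersed (cn n)) ∧
      Tendsto (fun n => H1Curves.distH1 lam c (cn n)) atTop (𝓝 0) := by
  choose cn hcn hdist using fun n : ℕ =>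
    -- At `n = 0` the tolerance is `⊤`, which is still positive.
    hc.exists_approx lam (ε := (n : ℝ≥0∞)⁻¹) (by simp)
  exact ⟨cn, hcn, tendsto_of_tendsto_of_tendsto_of_le_of_le tendsto_const_nhds
    ENNReal.tendsto_inv_nat_nhds_zero (fun _ => zero_le) hdist⟩
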